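/- Let $\{0,1\}^{\mathbb N}$ be the Cantor set of infinite binary sequences (product topology), $\{0,1\}^{<\mathbb N}$ the set of finite binary sequences, including the empty sequence $\emptyset$, and let homeomorphisms act from the right, so that $\xi\cdot(fg)=(\xi\cdot f)\cdot g$. Define homeomorphisms $x,y$ of $\{0,1\}^{\mathbb N}$ recursively by $$00\eta\cdot x=0\eta,\quad 01\eta\cdot x=10\eta,\quad 1\eta\cdot x=11\eta;$$ $$00\eta\cdot y=0(\eta\cdot y),\quad 01\eta\cdot y=10(\eta\cdot y^{-1}),\quad 1\eta\cdot y=11(\eta\cdot y).$$ For $s\in\{0,1\}^{<\mathbb N}$ let $x_s$ and $y_s$ be the homeomorphisms with $s\eta\cdot x_s=s(\eta\cdot x)$ and $s\eta\cdot y_s=s(\eta\cdot y)$ that fix every sequence without the prefix $s$. For $n\ge 0$ let $p_n$ be the homeomorphism with $1^k0\eta\cdot p_n=1^{k+1}0\eta$ for $0\le k\le n-1$, $1^n0\eta\cdot p_n=1^{n+1}\eta$ and $1^{n+1}\eta\cdot p_n=0\eta$. Let $F=\langle x_s\rangle$, ${}_yG_y=\langle F,\ y_s\rangle$, $T=\langle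 F,\ p_n\rangle$ (with $s\in\{0,1\}^{<\mathbb N}$, $n\ge 0$), and let $\widehat S=\langle {}_yG_y,T\rangle\le \mathrm{Homeo}(\{0,1\}^{\mathbb N})$. For $s\in\{0,1\}^{<\mathbb N}$ and a homeomorphism $f$ say that $s\cdot f$ is defined and equal to $u\in\{0,1\}^{<\mathbb N}$ if $s\eta\cdot f=u\eta$ for all $\eta\in\{0,1\}^{\mathbb N}$. Call $s,t$ independent if neither is a prefix of the other. **Proposition.** The group $\widehat S$ is presented by the generators $x_s,y_s,p_n$ ($s\in\{0,1\}^{<\mathbb N}$, $n\ge 0$) and the following relations, for all $s,t\in\{0,1\}^{<\mathbb N}$ and $m,n\ge 0$: 1. $x_s^2=x_{s0}\,x_s\,x_{s1}$; 2. $x_sx_t=x_tx_{s\cdot x_t}$ if $s\cdot x_t$ is defined; 3. $x_{1^m}^{-1}p_nx_{1^{m+1}}=p_{n+1}$ if $m<n$; $\ p_nx_\emptyset=p_{n+1}^2$; $\ p_n=x_{1^n}p_{n+1}$; $\ p_n^{n+2}=1$; 4. $y_s=x_s\,y_{s0}\,y_{s10}^{-1}\,y_{s11}$; 5. $y_sx_t=x_ty_{s\cdot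 x_t}$ if $s\cdot x_t$ is defined; 6. $y_sp_n=p_ny_{s\cdot p_n}$ if $s\cdot p_n$ is defined; 7. $y_sy_t=y_ty_s$ if $s,t$ are independent. That is, sending each generator symbol to the homeomorphism of the same name induces an isomorphism from the abstract group with this presentation onto $\widehat S$. -/

import Mathlib

namespace LodhaMoore

/-- The Cantor set of infinite binary sequences, with the product topology;
`false` is the digit `0` and `true` is the digit `1`. -/
abbrev BinSeq : Type := ℕ → Bool

/-- Prepend one digit. -/
def cons (b : Bool) (ξ : BinSeq) : BinSeq
  | 0 => b
  | n + 1 => ξ n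

/-- Delete the first `k` digits. -/
def drop (k : ℕ) (ξ : BinSeq) : BinSeq := fun n => ξ (n + k)

/-- The concatenation `sη` of a finite and an infinite binary sequence. -/
def app : List Bool → BinSeq → BinSeq
  | [], η => η
  | b :: s, η => cons b (app s η)

/-- The finite sequence `1ⁿ`. -/
def ones (n : ℕ) : List Bool := List.replicate n true

theorem cons_drop (ξ : BinSeq) : cons (ξ 0) (drop 1 ξ) = ξ := by
  funext n; cases n <;> rfl

theorem drop_cons (b : Bool) (ξ : BinSeq) : drop 1 (cons b ξ) = ξ := rfl

theorem continuous_drop (k : ℕ) : Continuous (drop k) :=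
  continuous_pi fun n => continuous_apply (n + k)

theorem continuous_cons (b : Bool) : Continuous (cons b) :=
  continuous_pi fun n => by
    cases n
    · exact continuous_const
    · exact continuous_apply _

theorem continuous_app (s : List Bool) : Continuous (app s) := by
  induction s with
  | nil => exact continuous_id
  | cons b s ih => exact (continuous_cons b).comp ih

theorem continuous_ite_clopen {Y : Type*} [TopologicalSpace Y] {p : BinSeq → Prop}
    [DecidablePred p] {f g : BinSeq → Y} (hp : IsClopen {ξ | p ξ})
    (hf : Continuous f) (hg : Continuous g) :
    Continuous fun ξ => if p ξ then f ξ else g ξ :=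
  Continuous.if (fun a ha => by simp [hp.frontier_eq] at ha) hf hg

theorem isClopen_digit (i : ℕ) (b : Bool) : IsClopen {ξ : BinSeq | ξ i = b} :=
  (isClopen_discrete {b}).preimage (continuous_apply i)

theorem isClopen_ones (k : ℕ) : IsClopen {ξ : BinSeq | ∀ i < k, ξ i = true} := by
  have h : {ξ : BinSeq | ∀ i < k, ξ i = true} =
      ⋂ i ∈ Finset.range k, {ξ : BinSeq | ξ i = true} := by
    ext ξ; simp
  rw [h]
  exact isClopen_biInter_finset fun i _ => isClopen_digit i true

theorem app_two (ξ : BinSeq) : app [ξ 0, ξ 1] (drop 2 ξ) = ξ := by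
  funext n
  rcases n with _ | _ | n <;> rfl

/-- Every sequence has the form `00η`, `01η` or `1η`. -/
theorem cases_source (ξ : BinSeq) : (∃ η, ξ = app [false, false] η) ∨
    (∃ η, ξ = app [false, true] η) ∨ ∃ η, ξ = app [true] η := by
  have h := app_two ξ
  rcases h0 : ξ 0
  · rcases h1 : ξ 1
    · exact Or.inl ⟨drop 2 ξ, by rw [h0, h1] at h; exact h.symm⟩
    · exact Or.inr (Or.inl ⟨drop 2 ξ, by rw [h0, h1] at h; exact h.symm⟩)
  · exact Or.inr (Or.inr ⟨drop 1 ξ, by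
      have h' := cons_drop ξ
      rw [h0] at h'
      exact h'.symm⟩)

/-- Every sequence has the form `0η`, `10η` or `11η`. -/
theorem cases_target (ξ : BinSeq) : (∃ η, ξ = app [false] η) ∨
    (∃ η, ξ = app [true, false] η) ∨ ∃ η, ξ = app [true, true] η := by
  have h := app_two ξ
  rcases h0 : ξ 0
  · exact Or.inl ⟨drop 1 ξ, by
      have h' := cons_drop ξ
      rw [h0] at h'
      exact h'.symm⟩
  · rcases h1 : ξ 1
    · exact Or.inr (Or.inl ⟨drop 2 ξ, by rw [h0, h1] at h; exact h.symm⟩)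
    · exact Or.inr (Or.inr ⟨drop 2 ξ, by rw [h0, h1] at h; exact h.symm⟩)

/-! ### The map `x` -/

/-- `00η ↦ 0η`, `01η ↦ 10η`, `1η ↦ 11η`. -/
def xFun (ξ : BinSeq) : BinSeq :=
  if ξ 0 = true then app [true, true] (drop 1 ξ)
  else if ξ 1 = true then app [true, false] (drop 2 ξ)
  else app [false] (drop 2 ξ)

/-- `0η ↦ 00η`, `10η ↦ 01η`, `11η ↦ 1η`. -/
def xInvFun (ξ : BinSeq) : BinSeq :=
  if ξ 0 = false then app [false, false] (drop 1 ξ)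
  else if ξ 1 = false then app [false, true] (drop 2 ξ)
  else app [true] (drop 2 ξ)

theorem xFun_00 (η : BinSeq) : xFun (app [false, false] η) = app [false] η := rfl
theorem xFun_01 (η : BinSeq) : xFun (app [false, true] η) = app [true, false] η := rfl
theorem xFun_1 (η : BinSeq) : xFun (app [true] η) = app [true, true] η := rfl
theorem xInvFun_0 (η : BinSeq) : xInvFun (app [false] η) = app [false, false] η := rfl
theorem xInvFun_10 (η : BinSeq) : xInvFun (app [true, false] η) = app [false, true] η := rfl
theorem xInvFun_11 (η : BinSeq) : xInvFun (app [true, true] η) = app [true] η := rfl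

/-- The homeomorphism `x` of the Cantor set. -/
def x : BinSeq ≃ₜ BinSeq where
  toFun := xFun
  invFun := xInvFun
  left_inv ξ := by
    rcases cases_source ξ with ⟨η, rfl⟩ | ⟨η, rfl⟩ | ⟨η, rfl⟩ <;> rfl
  right_inv ξ := by
    rcases cases_target ξ with ⟨η, rfl⟩ | ⟨η, rfl⟩ | ⟨η, rfl⟩ <;> rfl
  continuous_toFun :=
    continuous_ite_clopen (isClopen_digit 0 true) ((continuous_app _).comp (continuous_drop _))
      (continuous_ite_clopen (isClopen_digit 1 true)
        ((continuous_app _).comp (continuous_drop _))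
        ((continuous_app _).comp (continuous_drop _)))
  continuous_invFun :=
    continuous_ite_clopen (isClopen_digit 0 false) ((continuous_app _).comp (continuous_drop _))
      (continuous_ite_clopen (isClopen_digit 1 false)
        ((continuous_app _).comp (continuous_drop _))
        ((continuous_app _).comp (continuous_drop _)))

/-! ### The map `y` -/

/-- The `n`-th digit of the image of a sequence under `y` (if the flag is `true`) or under the
inverse of `y` (if the flag is `false`), computed from the recursive rules
`00η ↦ 0(η·y)`, `01η ↦ 10(η·y⁻¹)`, `1η ↦ 11(η·y)` for `y` and
`0η ↦ 00(η·y⁻¹)`, `10η ↦ 01(η·y)`, `11η ↦ 1(η·y⁻¹)` for `y⁻¹`;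
the lemmas `yFun_00` to `yInvFun_11` below are these rules. -/
def yDigit : ℕ → Bool → BinSeq → Bool
  | 0, true, ξ => ξ 0 || ξ 1
  | 1, true, ξ =>
      if ξ 0 = true then true
      else if ξ 1 = true then false
      else yDigit 0 true (drop 2 ξ)
  | n + 2, true, ξ =>
      if ξ 0 = true then yDigit n true (drop 1 ξ)
      else if ξ 1 = true then yDigit n false (drop 2 ξ)
      else yDigit (n + 1) true (drop 2 ξ)
  | 0, false, ξ => ξ 0 && ξ 1
  | 1, false, ξ =>
      if ξ 0 = false then false
      else if ξ 1 = false then true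
      else yDigit 0 false (drop 2 ξ)
  | n + 2, false, ξ =>
      if ξ 0 = false then yDigit n false (drop 1 ξ)
      else if ξ 1 = false then yDigit n true (drop 2 ξ)
      else yDigit (n + 1) false (drop 2 ξ)

def yFun (ξ : BinSeq) : BinSeq := fun n => yDigit n true ξ

def yInvFun (ξ : BinSeq) : BinSeq := fun n => yDigit n false ξ

theorem yFun_00 (η : BinSeq) : yFun (app [false, false] η) = app [false] (yFun η) := by
  funext n; rcases n with _ | _ | n <;> rfl

theorem yFun_01 (η : BinSeq) : yFun (app [false, true] η) = app [true, false] (yInvFun η) := by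
  funext n; rcases n with _ | _ | n <;> rfl

theorem yFun_1 (η : BinSeq) : yFun (app [true] η) = app [true, true] (yFun η) := by
  funext n; rcases n with _ | _ | n <;> rfl

theorem yInvFun_0 (η : BinSeq) : yInvFun (app [false] η) = app [false, false] (yInvFun η) := by
  funext n; rcases n with _ | _ | n <;> rfl

theorem yInvFun_10 (η : BinSeq) : yInvFun (app [true, false] η) = app [false, true] (yFun η) := by
  funext n; rcases n with _ | _ | n <;> rfl

theorem yInvFun_11 (η : BinSeq) : yInvFun (app [true, true] η) = app [true] (yInvFun η) := by
  funext n; rcases n with _ | _ | n <;> rfl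

theorem yFun_yInvFun_aux (n : ℕ) :
    (∀ ξ, yInvFun (yFun ξ) n = ξ n) ∧ ∀ ξ, yFun (yInvFun ξ) n = ξ n := by
  induction n using Nat.strong_induction_on with
  | _ n ih =>
    constructor
    · intro ξ
      rcases cases_source ξ with ⟨η, rfl⟩ | ⟨η, rfl⟩ | ⟨η, rfl⟩
      · rw [yFun_00, yInvFun_0]
        rcases n with _ | _ | n
        · rfl
        · rfl
        · exact (ih n (by omega)).1 η
      · rw [yFun_01, yInvFun_10]
        rcases n with _ | _ | n
        · rfl
        · rfl
        · exact (ih n (by omega)).2 η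
      · rw [yFun_1, yInvFun_11]
        rcases n with _ | n
        · rfl
        · exact (ih n (by omega)).1 η
    · intro ξ
      rcases cases_target ξ with ⟨η, rfl⟩ | ⟨η, rfl⟩ | ⟨η, rfl⟩
      · rw [yInvFun_0, yFun_00]
        rcases n with _ | n
        · rfl
        · exact (ih n (by omega)).2 η
      · rw [yInvFun_10, yFun_01]
        rcases n with _ | _ | n
        · rfl
        · rfl
        · exact (ih n (by omega)).1 η
      · rw [yInvFun_11, yFun_1]
        rcases n with _ | _ | n
        · rfl
        · rfl
        · exact (ih n (by omega)).2 η

theorem continuous_yDigit (n : ℕ) (b : Bool) : Continuous (yDigit n b) := by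
  induction n using Nat.strong_induction_on generalizing b with
  | _ n ih =>
    rcases n with _ | _ | n <;> cases b
    · have h2 : Continuous fun ξ : BinSeq => (ξ 0, ξ 1) :=
        (continuous_apply 0).prodMk (continuous_apply 1)
      exact (continuous_of_discreteTopology (f := fun q : Bool × Bool => q.1 && q.2)).comp h2
    · have h2 : Continuous fun ξ : BinSeq => (ξ 0, ξ 1) :=
        (continuous_apply 0).prodMk (continuous_apply 1)
      exact (continuous_of_discreteTopology (f := fun q : Bool × Bool => q.1 || q.2)).comp h2
    · exact continuous_ite_clopen (isClopen_digit 0 false) continuous_const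
        (continuous_ite_clopen (isClopen_digit 1 false) continuous_const
          ((ih 0 (by omega) _).comp (continuous_drop _)))
    · exact continuous_ite_clopen (isClopen_digit 0 true) continuous_const
        (continuous_ite_clopen (isClopen_digit 1 true) continuous_const
          ((ih 0 (by omega) _).comp (continuous_drop _)))
    · exact continuous_ite_clopen (isClopen_digit 0 false)
        ((ih n (by omega) _).comp (continuous_drop _))
        (continuous_ite_clopen (isClopen_digit 1 false)
          ((ih n (by omega) _).comp (continuous_drop _))
          ((ih (n + 1) (by omega) _).comp (continuous_drop _)))
    · exact continuous_ite_clopen (isClopen_digit 0 true)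
        ((ih n (by omega) _).comp (continuous_drop _))
        (continuous_ite_clopen (isClopen_digit 1 true)
          ((ih n (by omega) _).comp (continuous_drop _))
          ((ih (n + 1) (by omega) _).comp (continuous_drop _)))

/-- The homeomorphism `y` of the Cantor set. -/
def y : BinSeq ≃ₜ BinSeq where
  toFun := yFun
  invFun := yInvFun
  left_inv ξ := funext fun n => (yFun_yInvFun_aux n).1 ξ
  right_inv ξ := funext fun n => (yFun_yInvFun_aux n).2 ξ
  continuous_toFun := continuous_pi fun n => continuous_yDigit n true
  continuous_invFun := continuous_pi fun n => continuous_yDigit n false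

/-! ### The maps `x_s` and `y_s` -/

/-- Apply `h` behind the first digit `b` and fix all sequences that start with the other digit. -/
def underFun (b : Bool) (h : BinSeq → BinSeq) (ξ : BinSeq) : BinSeq :=
  if ξ 0 = b then cons b (h (drop 1 ξ)) else ξ

theorem underFun_comp (b : Bool) (h k : BinSeq → BinSeq) (hk : ∀ ξ, k (h ξ) = ξ) (ξ : BinSeq) :
    underFun b k (underFun b h ξ) = ξ := by
  by_cases h0 : ξ 0 = b
  · have h1 : underFun b h ξ = cons b (h (drop 1 ξ)) := by simp [underFun, h0]
    have h2 : underFun b k (cons b (h (drop 1 ξ))) = cons b (k (h (drop 1 ξ))) := by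
      simp [underFun, cons, drop_cons]
    rw [h1, h2, hk, ← h0, cons_drop]
  · simp [underFun, h0]

theorem continuous_underFun (b : Bool) {h : BinSeq → BinSeq} (hh : Continuous h) :
    Continuous (underFun b h) :=
  continuous_ite_clopen (isClopen_digit 0 b)
    ((continuous_cons b).comp (hh.comp (continuous_drop 1))) continuous_id

def under (b : Bool) (h : BinSeq ≃ₜ BinSeq) : BinSeq ≃ₜ BinSeq where
  toFun := underFun b h
  invFun := underFun b h.symm
  left_inv := underFun_comp b h h.symm h.symm_apply_apply
  right_inv := underFun_comp b h.symm h h.apply_symm_apply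
  continuous_toFun := continuous_underFun b h.continuous
  continuous_invFun := continuous_underFun b h.symm.continuous

/-- The homeomorphism `sη ↦ s(η·h)` that fixes every sequence without the prefix `s`. -/
def localize : List Bool → (BinSeq ≃ₜ BinSeq) → (BinSeq ≃ₜ BinSeq)
  | [], h => h
  | b :: s, h => under b (localize s h)

theorem localize_app (s : List Bool) (h : BinSeq ≃ₜ BinSeq) (η : BinSeq) :
    localize s h (app s η) = app s (h η) := by
  induction s with
  | nil => rfl
  | cons b s ih =>
    change underFun b (localize s h) (cons b (app s η)) = cons b (app s (h η))
    rw [← ih]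
    simp [underFun, cons, drop_cons]

theorem localize_of_not_prefix (s : List Bool) (h : BinSeq ≃ₜ BinSeq) (ξ : BinSeq)
    (hξ : ∀ η, ξ ≠ app s η) : localize s h ξ = ξ := by
  induction s generalizing ξ with
  | nil => exact absurd rfl (hξ ξ)
  | cons b s ih =>
    change underFun b (localize s h) ξ = ξ
    by_cases h0 : ξ 0 = b
    · have h1 : localize s h (drop 1 ξ) = drop 1 ξ := by
        refine ih _ fun η hη => hξ η ?_
        rw [app, ← hη, ← h0, cons_drop]
      have h2 : underFun b (localize s h) ξ = cons b (localize s h (drop 1 ξ)) := by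
        simp [underFun, h0]
      rw [h2, h1, ← h0, cons_drop]
    · simp [underFun, h0]

/-- The homeomorphism `x_s`. -/
def xAt (s : List Bool) : BinSeq ≃ₜ BinSeq := localize s x

/-- The homeomorphism `y_s`. -/
def yAt (s : List Bool) : BinSeq ≃ₜ BinSeq := localize s y

/-! ### The maps `p_n` -/

/-- `1ⁿ⁺¹η ↦ 0η`, `1ⁿ0η ↦ 1ⁿ⁺¹η`, and `1ᵏ0η ↦ 1ᵏ⁺¹0η` for `k < n`. -/
def pFun (n : ℕ) (ξ : BinSeq) : BinSeq :=
  if ∀ i < n + 1, ξ i = true then app [false] (drop (n + 1) ξ)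
  else if ∀ i < n, ξ i = true then app (ones (n + 1)) (drop (n + 1) ξ)
  else app [true] ξ

/-- `0η ↦ 1ⁿ⁺¹η`, `1ⁿ⁺¹η ↦ 1ⁿ0η`, and `1ᵏ⁺¹0η ↦ 1ᵏ0η` for `k < n`. -/
def pInvFun (n : ℕ) (ξ : BinSeq) : BinSeq :=
  if ξ 0 = false then app (ones (n + 1)) (drop 1 ξ)
  else if ∀ i < n + 1, ξ i = true then app (ones n ++ [false]) (drop (n + 1) ξ)
  else drop 1 ξ

theorem app_append (s t : List Bool) (η : BinSeq) : app (s ++ t) η = app s (app t η) := by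
  induction s with
  | nil => rfl
  | cons b s ih =>
    change cons b (app (s ++ t) η) = cons b (app s (app t η))
    rw [ih]

theorem drop_app (s : List Bool) (η : BinSeq) : drop s.length (app s η) = η := by
  induction s with
  | nil => rfl
  | cons b s ih => exact ih

theorem app_ones_of_lt (k : ℕ) (η : BinSeq) {i : ℕ} (hi : i < k) :
    app (ones k) η i = true := by
  induction k generalizing i with
  | zero => omega
  | succ k ih =>
    rcases i with _ | i
    · rfl
    · exact ih (by omega)

theorem drop_app_ones (k : ℕ) (η : BinSeq) : drop k (app (ones k) η) = η := by
  have h := drop_app (ones k) η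
  rwa [ones, List.length_replicate] at h

theorem app_ones_false_self (k : ℕ) (η : BinSeq) : app (ones k ++ [false]) η k = false := by
  induction k with
  | zero => rfl
  | succ k ih => exact ih

theorem drop_app_ones_false (k : ℕ) (η : BinSeq) :
    drop (k + 1) (app (ones k ++ [false]) η) = η := by
  have h := drop_app (ones k ++ [false]) η
  rwa [List.length_append, ones, List.length_replicate] at h

theorem exists_app_ones {k : ℕ} {ξ : BinSeq} (h : ∀ i < k, ξ i = true) :
    ∃ η, ξ = app (ones k) η := by
  induction k generalizing ξ with
  | zero => exact ⟨ξ, rfl⟩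
  | succ k ih =>
    obtain ⟨η, hη⟩ := ih (ξ := drop 1 ξ) fun i hi => h (i + 1) (by omega)
    refine ⟨η, ?_⟩
    change ξ = cons true (app (ones k) η)
    rw [← hη, ← h 0 (by omega), cons_drop]

/-- Every sequence has the form `1ⁿ⁺¹η` or `1ᵏ0η` with `k ≤ n`. -/
theorem cases_p (n : ℕ) (ξ : BinSeq) :
    (∃ η, ξ = app (ones (n + 1)) η) ∨ ∃ k ≤ n, ∃ η, ξ = app (ones k ++ [false]) η := by
  by_cases h : ∀ i < n + 1, ξ i = true
  · exact Or.inl (exists_app_ones h)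
  · right
    have h' : ∃ i, i < n + 1 ∧ ξ i = false := by simpa using h
    classical
    obtain ⟨hk, hk0⟩ := Nat.find_spec h'
    obtain ⟨η, hη⟩ := exists_app_ones (k := Nat.find h') (ξ := ξ) fun i hi => by
      have := Nat.find_min h' hi
      have : ξ i ≠ false := fun h0 => this ⟨by omega, h0⟩
      simpa using this
    refine ⟨Nat.find h', by omega, drop 1 η, ?_⟩
    have h0 : η 0 = false := by
      have h1 := drop_app_ones (Nat.find h') η
      rw [← hη] at h1
      rw [← h1]
      simpa [drop] using hk0
    rw [app_append]
    have h2 := cons_drop η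
    rw [h0] at h2
    change ξ = app _ (cons false (drop 1 η))
    rw [h2]
    exact hη

theorem pFun_ones (n : ℕ) (η : BinSeq) : pFun n (app (ones (n + 1)) η) = app [false] η := by
  rw [pFun, if_pos fun i hi => app_ones_of_lt _ _ hi, drop_app_ones]

theorem pFun_last (n : ℕ) (η : BinSeq) :
    pFun n (app (ones n ++ [false]) η) = app (ones (n + 1)) η := by
  rw [pFun, if_neg, if_pos, drop_app_ones_false]
  · intro i hi
    rw [app_append]
    exact app_ones_of_lt _ _ hi
  · intro h
    have h1 := h n (by omega)
    rw [app_ones_false_self] at h1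
    exact absurd h1 (by simp)

theorem pFun_of_lt {k n : ℕ} (hk : k < n) (η : BinSeq) :
    pFun n (app (ones k ++ [false]) η) = app (ones (k + 1) ++ [false]) η := by
  have key : ¬ app (ones k ++ [false]) η k = true := by
    rw [app_ones_false_self]; simp
  rw [pFun, if_neg fun h => key (h k (by omega)), if_neg fun h => key (h k hk)]
  rfl

theorem pInvFun_zero (n : ℕ) (η : BinSeq) : pInvFun n (app [false] η) = app (ones (n + 1)) η :=
  rfl

theorem pInvFun_ones (n : ℕ) (η : BinSeq) :
    pInvFun n (app (ones (n + 1)) η) = app (ones n ++ [false]) η := by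
  rw [pInvFun, if_neg, if_pos fun i hi => app_ones_of_lt _ _ hi, drop_app_ones]
  rw [app_ones_of_lt _ _ (by omega)]
  simp

theorem pInvFun_of_lt {k n : ℕ} (hk : k < n) (η : BinSeq) :
    pInvFun n (app (ones (k + 1) ++ [false]) η) = app (ones k ++ [false]) η := by
  rw [pInvFun, if_neg, if_neg]
  · rfl
  · intro h
    have h1 := h (k + 1) (by omega)
    rw [app_ones_false_self] at h1
    exact absurd h1 (by simp)
  · rw [app_append, app_ones_of_lt _ _ (by omega)]
    simp

theorem pInvFun_pFun (n : ℕ) (ξ : BinSeq) : pInvFun n (pFun n ξ) = ξ := by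
  rcases cases_p n ξ with ⟨η, rfl⟩ | ⟨k, hk, η, rfl⟩
  · rw [pFun_ones, pInvFun_zero]
  · rcases hk.lt_or_eq with hk | rfl
    · rw [pFun_of_lt hk, pInvFun_of_lt hk]
    · rw [pFun_last, pInvFun_ones]

theorem pFun_pInvFun (n : ℕ) (ξ : BinSeq) : pFun n (pInvFun n ξ) = ξ := by
  rcases cases_p n ξ with ⟨η, rfl⟩ | ⟨k, hk, η, rfl⟩
  · rw [pInvFun_ones, pFun_last]
  · rcases k with _ | k
    · change pFun n (pInvFun n (app [false] η)) = app [false] η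
      rw [pInvFun_zero, pFun_ones]
    · rw [pInvFun_of_lt (by omega), pFun_of_lt (by omega)]

/-- The homeomorphism `p_n`. -/
def p (n : ℕ) : BinSeq ≃ₜ BinSeq where
  toFun := pFun n
  invFun := pInvFun n
  left_inv := pInvFun_pFun n
  right_inv := pFun_pInvFun n
  continuous_toFun :=
    continuous_ite_clopen (isClopen_ones _) ((continuous_app _).comp (continuous_drop _))
      (continuous_ite_clopen (isClopen_ones _)
        ((continuous_app _).comp (continuous_drop _)) (continuous_app _))
  continuous_invFun :=
    continuous_ite_clopen (isClopen_digit 0 false) ((continuous_app _).comp (continuous_drop _))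
      (continuous_ite_clopen (isClopen_ones _)
        ((continuous_app _).comp (continuous_drop _)) (continuous_drop _))

/-! ### The groups

Homeomorphisms act on the Cantor set from the right, so that `f g` means: first `f`, then `g`.
Mathlib's product on `BinSeq ≃ₜ BinSeq` is composition of functions (first the right factor), so
the group of the text is its opposite. -/

/-- The group of homeomorphisms of the Cantor set, with products read from left to right. -/
abbrev HomeoR : Type := (BinSeq ≃ₜ BinSeq)ᵐᵒᵖ

/-- Thompson's group `F`. -/
def thompsonF : Subgroup HomeoR :=
  Subgroup.closure (Set.range fun s : List Bool => MulOpposite.op (xAt s))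

/-- The Lodha–Moore group `_yG_y`. -/
def yGy : Subgroup HomeoR :=
  Subgroup.closure
    ((thompsonF : Set HomeoR) ∪ Set.range fun s : List Bool => MulOpposite.op (yAt s))

/-- Thompson's group `T`. -/
def thompsonT : Subgroup HomeoR :=
  Subgroup.closure ((thompsonF : Set HomeoR) ∪ Set.range fun n : ℕ => MulOpposite.op (p n))

/-- The group `Ŝ` generated by `_yG_y` and `T`. -/
def SHat : Subgroup HomeoR := yGy ⊔ thompsonT

/-! ### The presentation -/

/-- The abstract generators: one symbol for each `y_s`, `x_s`, `p_n`. -/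
inductive Gen : Type
  | y (s : List Bool)
  | x (s : List Bool)
  | p (n : ℕ)

/-- The homeomorphism that a generator symbol stands for. -/
def Gen.toHomeo : Gen → HomeoR
  | .y s => MulOpposite.op (yAt s)
  | .x s => MulOpposite.op (xAt s)
  | .p n => MulOpposite.op (LodhaMoore.p n)

/-- The partial action on finite sequences: `s · f` is defined and equal to `t`, that is,
`f` replaces the prefix `s` by `t`. -/
def ActsTo (f : BinSeq ≃ₜ BinSeq) (s t : List Bool) : Prop :=
  ∀ η : BinSeq, f (app s η) = app t η

/-- Two finite sequences are independent if neither is a prefix of the other. -/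
def Independent (s t : List Bool) : Prop := ¬ s <+: t ∧ ¬ t <+: s

/-- The letter `y_s` of the free group on the generators. -/
def Y (s : List Bool) : FreeGroup Gen := FreeGroup.of (Gen.y s)

/-- The letter `x_s` of the free group on the generators. -/
def X (s : List Bool) : FreeGroup Gen := FreeGroup.of (Gen.x s)

/-- The letter `p_n` of the free group on the generators. -/
def P (n : ℕ) : FreeGroup Gen := FreeGroup.of (Gen.p n)

/-- `Relation u v` says that `u = v` is one of the defining relations. -/
inductive Relation : FreeGroup Gen → FreeGroup Gen → Prop
  | x_sq (s : List Bool) :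
      Relation (X s ^ 2) (X (s ++ [false]) * X s * X (s ++ [true]))
  | x_x (s t u : List Bool) (h : ActsTo (xAt t) s u) :
      Relation (X s * X t) (X t * X u)
  | x_p_x (m n : ℕ) (h : m < n) :
      Relation ((X (ones m))⁻¹ * P n * X (ones (m + 1))) (P (n + 1))
  | p_x (n : ℕ) :
      Relation (P n * X []) (P (n + 1) ^ 2)
  | p_eq (n : ℕ) :
      Relation (P n) (X (ones n) * P (n + 1))
  | p_pow (n : ℕ) :
      Relation (P n ^ (n + 2)) 1
  | y_expand (s : List Bool) :
      Relation (Y s)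
        (X s * Y (s ++ [false]) * (Y (s ++ [true, false]))⁻¹ * Y (s ++ [true, true]))
  | y_x (s t u : List Bool) (h : ActsTo (xAt t) s u) :
      Relation (Y s * X t) (X t * Y u)
  | y_p (s : List Bool) (n : ℕ) (u : List Bool) (h : ActsTo (LodhaMoore.p n) s u) :
      Relation (Y s * P n) (P n * Y u)
  | y_y (s t : List Bool) (h : Independent s t) :
      Relation (Y s * Y t) (Y t * Y s)

/-- The set of relators `u v⁻¹`, one for each defining relation `u = v`. -/
def relators : Set (FreeGroup Gen) := {r | ∃ u v, Relation u v ∧ r = u * v⁻¹}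

end LodhaMoore

namespace LodhaMoore

/-! ### Cones of the Cantor set -/

/-! The relations hold in the homeomorphism group by inspection on cones, and the image of the
generators generates `SHat`; the content is injectivity. It rests on a normal form in the presented
group: every element is `τ * eval [] t`, where `τ` lies in the subgroup `presT` generated by the
letters `x` and `p`, and `t` is a finite binary tree with integer exponents of `y` at its vertices,
reduced in the sense that no cancellation can occur along a branch.

Existence (`hasNormalForm`). The relation `y_expand` and its inverse trade a factor `y` or `y⁻¹` at
a vertex for a rotation `x` and factors further down. `exists_deepen` iterates this until the root
carries no exponent, without raising the total exponent along branches and without losing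
reducedness. Once the root is empty, the two halves lie in commuting subgroups, so the set of normal
forms can be shown to be stable under right multiplication by each generator and its inverse.

The tree part is detected by the action. View `y` and `y⁻¹` as transducers with three phases.
Reducedness says that a transducer coming from above never reaches an exponent of the opposite sign
in a phase where it would cancel with it. Hence for a reduced tree with a nonzero exponent there is
a cone on which the map is `ζ ↦ u (ζ · y^k)` with `k ≠ 0` (`escapes_of_reduced`). Such a map is not
a local replacement of prefixes (`not_locallyPrefix_of_escapes`), whereas every element of `presT`
is. So if `τ * eval [] t` acts trivially, then all exponents of `t` vanish and only `τ` remains.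

Finally `presT` acts faithfully (`eq_one_of_mem_presT`). Each of its elements is given by two trees
with equally many leaves and a cyclic shift between them: rotate the first tree to the right vine,
apply a power of `p`, and rotate back to the second tree. A trivial action forces the trees to
coincide and the shift to vanish. -/

theorem cons_injective2 {a b : Bool} {ξ η : BinSeq} (h : cons a ξ = cons b η) : a = b ∧ ξ = η :=
  ⟨congrFun h 0, by rw [← drop_cons a ξ, h, drop_cons]⟩

theorem app_injective (s : List Bool) : Function.Injective (app s) := fun a b h => by
  rw [← drop_app s a, h, drop_app]

theorem prefix_or_of_app_eq {s t : List Bool} {η ζ : BinSeq} (h : app s η = app t ζ) :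
    s <+: t ∨ t <+: s := by
  induction s generalizing t with
  | nil => exact Or.inl (List.nil_prefix)
  | cons a s ih =>
    cases t with
    | nil => exact Or.inr (List.nil_prefix)
    | cons b t =>
      obtain ⟨rfl, h'⟩ := cons_injective2 h
      rcases ih h' with h | h
      · exact Or.inl ((List.prefix_cons_inj a).2 h)
      · exact Or.inr ((List.prefix_cons_inj a).2 h)

theorem Independent.app_ne {s t : List Bool} (h : Independent s t) (η ζ : BinSeq) :
    app s η ≠ app t ζ := fun e => (prefix_or_of_app_eq e).elim h.1 h.2

theorem Independent.symm {s t : List Bool} (h : Independent s t) : Independent t s := ⟨h.2, h.1⟩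

theorem independent_append (r : List Bool) {b c : Bool} (h : b ≠ c) (s t : List Bool) :
    Independent (r ++ b :: s) (r ++ c :: t) := by
  constructor <;> rw [List.prefix_append_right_inj, List.cons_prefix_cons] <;>
    rintro ⟨h', -⟩ <;> simp_all

theorem exists_cons (ξ : BinSeq) : ∃ b η, ξ = cons b η := ⟨ξ 0, drop 1 ξ, (cons_drop ξ).symm⟩

/-! ### Localization -/

theorem localize_append (s t : List Bool) (h : BinSeq ≃ₜ BinSeq) :
    localize (s ++ t) h = localize s (localize t h) := by
  induction s with
  | nil => rfl
  | cons b s ih => rw [List.cons_append, localize, ih, localize]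

theorem under_cons (b c : Bool) (h : BinSeq ≃ₜ BinSeq) (η : BinSeq) :
    under b h (cons c η) = if c = b then cons b (h η) else cons c η := rfl

theorem localize_mul (s : List Bool) (f g : BinSeq ≃ₜ BinSeq) :
    localize s (f * g) = localize s f * localize s g := by
  induction s with
  | nil => rfl
  | cons b s ih =>
    rw [localize, ih]
    ext1 ξ
    obtain ⟨c, η, rfl⟩ := exists_cons ξ
    by_cases hc : c = b
    · subst hc; simp [localize, under_cons]
    · simp [localize, under_cons, hc]

theorem localize_one (s : List Bool) : localize s 1 = 1 := by
  have h := localize_mul s 1 1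
  rw [mul_one] at h
  exact mul_eq_left.1 h.symm

/-- Localization at a cone, as a homomorphism. -/
def localizeHom (s : List Bool) : HomeoR →* HomeoR where
  toFun g := MulOpposite.op (localize s g.unop)
  map_one' := by rw [MulOpposite.unop_one, localize_one, MulOpposite.op_one]
  map_mul' f g := by rw [MulOpposite.unop_mul, localize_mul, MulOpposite.op_mul]

theorem localizeHom_xAt (s t : List Bool) :
    localizeHom s (MulOpposite.op (xAt t)) = MulOpposite.op (xAt (s ++ t)) :=
  congrArg MulOpposite.op (localize_append s t x).symm

theorem localizeHom_yAt (s t : List Bool) :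
    localizeHom s (MulOpposite.op (yAt t)) = MulOpposite.op (yAt (s ++ t)) :=
  congrArg MulOpposite.op (localize_append s t y).symm

theorem homeoR_ext {g h : HomeoR} (H : ∀ ξ, g.unop ξ = h.unop ξ) : g = h :=
  MulOpposite.unop_injective (Homeomorph.ext H)

theorem unop_mul_apply (g h : HomeoR) (ξ : BinSeq) : (g * h).unop ξ = h.unop (g.unop ξ) := rfl

/-- A conjugate of a localized map by a map that replaces the prefix `s` by `u` is localized at `u`.
The relations `x_x`, `y_x`, `y_p` and `y_y` are all instances. -/
theorem localize_comm_of_actsTo {f : BinSeq ≃ₜ BinSeq} {s u : List Bool} (h : ActsTo f s u)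
    (k : BinSeq ≃ₜ BinSeq) (ξ : BinSeq) : f (localize s k ξ) = localize u k (f ξ) := by
  by_cases hξ : ∃ η, ξ = app s η
  · obtain ⟨η, rfl⟩ := hξ
    rw [localize_app, h, h, localize_app]
  · push Not at hξ
    rw [localize_of_not_prefix s k ξ hξ, localize_of_not_prefix]
    intro η hη
    rw [← h] at hη
    exact hξ η (f.injective hη)

theorem ActsTo.localize_of_independent {s t : List Bool} (h : Independent s t)
    (k : BinSeq ≃ₜ BinSeq) : ActsTo (localize t k) s s := fun η =>
  localize_of_not_prefix t k _ fun ζ => h.app_ne η ζ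

theorem ActsTo.localize_append {k : BinSeq ≃ₜ BinSeq} {s u : List Bool} (h : ActsTo k s u)
    (t : List Bool) : ActsTo (localize t k) (t ++ s) (t ++ u) := fun η => by
  rw [app_append, localize_app, h, app_append]

theorem ActsTo.append {k : BinSeq ≃ₜ BinSeq} {s u : List Bool} (h : ActsTo k s u)
    (t : List Bool) : ActsTo k (s ++ t) (u ++ t) := fun η => by
  rw [app_append, h, app_append]

theorem actsTo_x_00 : ActsTo x [false, false] [false] := xFun_00
theorem actsTo_x_01 : ActsTo x [false, true] [true, false] := xFun_01
theorem actsTo_x_1 : ActsTo x [true] [true, true] := xFun_1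

theorem actsTo_xAt_00 (t w : List Bool) :
    ActsTo (xAt t) (t ++ false :: false :: w) (t ++ false :: w) :=
  ((actsTo_x_00.append w).localize_append t)

theorem actsTo_xAt_01 (t w : List Bool) :
    ActsTo (xAt t) (t ++ false :: true :: w) (t ++ true :: false :: w) :=
  ((actsTo_x_01.append w).localize_append t)

theorem actsTo_xAt_1 (t w : List Bool) :
    ActsTo (xAt t) (t ++ true :: w) (t ++ true :: true :: w) :=
  ((actsTo_x_1.append w).localize_append t)

/-! ### The leaves of the right vine -/

/-- The `i`-th leaf of the right vine with `n` leaves. -/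
def vineLeaf (n i : ℕ) : List Bool := if i + 1 < n then ones i ++ [false] else ones i

theorem ones_succ (n : ℕ) : ones (n + 1) = true :: ones n := rfl

theorem ones_add (m n : ℕ) : ones (m + n) = ones m ++ ones n := List.replicate_add ..

theorem vineLeaf_zero (n : ℕ) : vineLeaf (n + 2) 0 = [false] := if_pos (by omega)

theorem vineLeaf_succ (n i : ℕ) : vineLeaf (n + 1) (i + 1) = true :: vineLeaf n i := by
  unfold vineLeaf
  by_cases h : i + 1 < n
  · rw [if_pos h, if_pos (by omega), ones_succ]; rfl
  · rw [if_neg h, if_neg (by omega), ones_succ]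

theorem exists_vineLeaf (n : ℕ) (ξ : BinSeq) : ∃ i < n + 1, ∃ η, ξ = app (vineLeaf (n + 1) i) η := by
  induction n generalizing ξ with
  | zero => exact ⟨0, by omega, ξ, rfl⟩
  | succ n ih =>
    obtain ⟨b, ζ, rfl⟩ := exists_cons ξ
    cases b
    · exact ⟨0, by omega, ζ, by rw [vineLeaf_zero]; rfl⟩
    · obtain ⟨i, hi, η, rfl⟩ := ih ζ
      exact ⟨i + 1, by omega, η, by rw [vineLeaf_succ]; rfl⟩

/-- The three clauses that define `p n` are a single cyclic shift of the `n + 2` vine cones, so the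
relations between `x` and `p` reduce to index arithmetic. -/
theorem actsTo_p {n i : ℕ} (hi : i < n + 2) :
    ActsTo (p n) (vineLeaf (n + 2) i) (vineLeaf (n + 2) ((i + 1) % (n + 2))) := by
  rcases (show i < n ∨ i = n ∨ i = n + 1 by omega) with h | rfl | rfl
  · rw [Nat.mod_eq_of_lt (by omega), vineLeaf, vineLeaf, if_pos (by omega), if_pos (by omega)]
    exact pFun_of_lt h
  · rw [Nat.mod_eq_of_lt (by omega), vineLeaf, vineLeaf, if_pos (by omega), if_neg (by omega)]
    exact pFun_last i
  · rw [Nat.mod_self, vineLeaf_zero, vineLeaf, if_neg (by omega)]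
    exact pFun_ones n

theorem actsTo_xAt_ones_lt {m n i : ℕ} (hm : m + 1 < n) (hi : i < m) :
    ActsTo (xAt (ones m)) (vineLeaf n i) (vineLeaf (n + 1) i) := by
  rw [vineLeaf, vineLeaf, if_pos (by omega), if_pos (by omega)]
  refine ActsTo.localize_of_independent ?_ x
  obtain ⟨k, rfl⟩ : ∃ k, m = i + (k + 1) := ⟨m - i - 1, by omega⟩
  rw [ones_add, ones_succ]
  exact independent_append _ (by simp) _ _

theorem actsTo_xAt_ones_gt {m n i : ℕ} (hi : m < i) :
    ActsTo (xAt (ones m)) (vineLeaf n i) (vineLeaf (n + 1) (i + 1)) := by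
  obtain ⟨k, rfl⟩ : ∃ k, i = m + (k + 1) := ⟨i - m - 1, by omega⟩
  unfold vineLeaf
  rw [ones_succ, ones_add, ones_succ, show true :: (ones m ++ true :: ones k) =
    ones m ++ true :: true :: ones k by rw [← List.cons_append, ← ones_succ, ones_add]; simp [ones]]
  by_cases h : m + (k + 1) + 1 < n
  · rw [if_pos (by omega), if_pos (by omega)]
    simpa using actsTo_xAt_1 (ones m) (ones k ++ [false])
  · rw [if_neg (by omega), if_neg (by omega)]
    exact actsTo_xAt_1 (ones m) (ones k)

theorem actsTo_xAt_ones_false {m n : ℕ} (hm : m + 1 < n) :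
    ActsTo (xAt (ones m)) (vineLeaf n m ++ [false]) (vineLeaf (n + 1) m) := by
  rw [vineLeaf, vineLeaf, if_pos hm, if_pos (by omega)]
  simpa using actsTo_xAt_00 (ones m) []

theorem actsTo_xAt_ones_true {m n : ℕ} (hm : m + 1 < n) :
    ActsTo (xAt (ones m)) (vineLeaf n m ++ [true]) (vineLeaf (n + 1) (m + 1)) := by
  rw [vineLeaf, vineLeaf, if_pos hm, if_pos (by omega)]
  have := actsTo_xAt_01 (ones m) []
  rw [ones_add]
  simpa [ones] using this

theorem vineLeaf_last_false (n : ℕ) : vineLeaf (n + 1) n ++ [false] = vineLeaf (n + 2) n := by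
  rw [vineLeaf, vineLeaf, if_neg (by omega), if_pos (by omega)]

theorem vineLeaf_last_true (n : ℕ) : vineLeaf (n + 1) n ++ [true] = vineLeaf (n + 2) (n + 1) := by
  rw [vineLeaf, vineLeaf, if_neg (by omega), if_neg (by omega), ones_add]; rfl

/-! ### The defining relations hold -/

/-- Two homeomorphisms that act in the same way on the leaves of a vine are equal. -/
theorem homeoR_ext_vine (n : ℕ) {g h : HomeoR}
    (H : ∀ i < n + 1, ∀ η, g.unop (app (vineLeaf (n + 1) i) η) = h.unop (app (vineLeaf (n + 1) i) η)) :
    g = h :=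
  homeoR_ext fun ξ => by
    obtain ⟨i, hi, η, rfl⟩ := exists_vineLeaf n ξ
    exact H i hi η

open MulOpposite in
theorem op_x_sq : (op (xAt []) : HomeoR) ^ 2 = op (xAt [false]) * op (xAt []) * op (xAt [true]) := by
  refine homeoR_ext fun ξ => ?_
  obtain ⟨a, ξ, rfl⟩ := exists_cons ξ
  cases a
  · obtain ⟨b, ξ, rfl⟩ := exists_cons ξ
    cases b
    · obtain ⟨c, ξ, rfl⟩ := exists_cons ξ
      cases c <;> rfl
    · rfl
  · rfl

open MulOpposite in
theorem op_y_expand : (op (yAt []) : HomeoR) = op (xAt []) * op (yAt [false]) *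
    (op (yAt [true, false]))⁻¹ * op (yAt [true, true]) := by
  refine homeoR_ext fun ξ => ?_
  rcases cases_source ξ with ⟨η, rfl⟩ | ⟨η, rfl⟩ | ⟨η, rfl⟩
  · exact yFun_00 η
  · exact yFun_01 η
  · exact yFun_1 η

open MulOpposite in
theorem op_comm_of_actsTo {f : BinSeq ≃ₜ BinSeq} {s u : List Bool} (h : ActsTo f s u)
    (k : BinSeq ≃ₜ BinSeq) : (op (localize s k) * op f : HomeoR) = op f * op (localize u k) :=
  homeoR_ext fun ξ => localize_comm_of_actsTo h k ξ

open MulOpposite in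
theorem op_p_pow_apply (n i j : ℕ) (hi : i < n + 2) (η : BinSeq) :
    ((op (p n) : HomeoR) ^ j).unop (app (vineLeaf (n + 2) i) η) =
      app (vineLeaf (n + 2) ((i + j) % (n + 2))) η := by
  induction j with
  | zero => rw [pow_zero, Nat.mod_eq_of_lt (show i + 0 < n + 2 from hi)]; rfl
  | succ j ih =>
    rw [pow_succ, unop_mul_apply, ih]
    refine (actsTo_p (Nat.mod_lt _ (by omega)) η).trans ?_
    rw [Nat.mod_add_mod, ← Nat.add_assoc]

open MulOpposite in
theorem op_p_pow (n : ℕ) : (op (p n) : HomeoR) ^ (n + 2) = 1 :=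
  homeoR_ext_vine (n + 1) fun i hi η => by
    rw [op_p_pow_apply n i _ hi, Nat.add_mod_right, Nat.mod_eq_of_lt hi]; rfl

open MulOpposite in
theorem op_p_mul_x (m n : ℕ) (h : m < n) :
    (op (p n) * op (xAt (ones (m + 1))) : HomeoR) = op (xAt (ones m)) * op (p (n + 1)) := by
  refine homeoR_ext_vine (n + 1) fun i hi η => ?_
  change xAt (ones (m + 1)) (p n _) = p (n + 1) (xAt (ones m) _)
  rw [actsTo_p hi]
  rcases lt_trichotomy i m with h' | rfl | h'
  · rw [actsTo_xAt_ones_lt (by omega) h', actsTo_p (by omega), Nat.mod_eq_of_lt (by omega),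
      Nat.mod_eq_of_lt (by omega), actsTo_xAt_ones_lt (by omega) (by omega)]
  -- This is the leaf that the caret removed by `x` subdivides, so its two halves are followed
  -- separately.
  · obtain ⟨b, η, rfl⟩ := exists_cons η
    have e (s : List Bool) : app s (cons b η) = app (s ++ [b]) η := by rw [app_append]; rfl
    rw [e, e, Nat.mod_eq_of_lt (by omega)]
    cases b
    · rw [actsTo_xAt_ones_false (by omega), actsTo_xAt_ones_false (by omega), actsTo_p (by omega),
        Nat.mod_eq_of_lt (by omega)]
    · rw [actsTo_xAt_ones_true (by omega), actsTo_xAt_ones_true (by omega), actsTo_p (by omega),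
        Nat.mod_eq_of_lt (by omega)]
  · rw [actsTo_xAt_ones_gt h', actsTo_p (by omega)]
    rcases (show i ≤ n ∨ i = n + 1 by omega) with h1 | rfl
    · rw [Nat.mod_eq_of_lt (by omega), Nat.mod_eq_of_lt (by omega), actsTo_xAt_ones_gt (by omega)]
    · rw [Nat.mod_self, Nat.mod_self, actsTo_xAt_ones_lt (by omega) (by omega)]

open MulOpposite in
theorem op_p_mul_x_nil (n : ℕ) :
    (op (p n) * op (xAt []) : HomeoR) = op (p (n + 1)) ^ 2 := by
  refine homeoR_ext_vine (n + 1) fun i hi η => ?_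
  change xAt (ones 0) (p n _) = p (n + 1) (p (n + 1) _)
  rw [actsTo_p hi]
  rcases (show i ≤ n ∨ i = n + 1 by omega) with h1 | rfl
  -- Every leaf but the last of the vine with `n + 2` leaves is also a leaf of the vine with `n + 3`
  -- leaves.
  · have h2 : ActsTo (p (n + 1)) (vineLeaf (n + 2) i) (vineLeaf (n + 3) (i + 1)) := by
      have h3 := actsTo_p (n := n + 1) (i := i) (by omega)
      rw [Nat.mod_eq_of_lt (by omega)] at h3
      rwa [vineLeaf, if_pos (by omega)] at h3 ⊢
    rw [h2, actsTo_p (by omega), Nat.mod_eq_of_lt (by omega), Nat.mod_eq_of_lt (by omega),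
      actsTo_xAt_ones_gt (by omega)]
  · obtain ⟨b, η, rfl⟩ := exists_cons η
    have e (s : List Bool) : app s (cons b η) = app (s ++ [b]) η := by rw [app_append]; rfl
    rw [e, e, Nat.mod_self]
    cases b
    · rw [actsTo_xAt_ones_false (by omega), vineLeaf_last_false, actsTo_p (by omega),
        Nat.mod_eq_of_lt (by omega), actsTo_p (by omega), Nat.mod_self]
    · rw [actsTo_xAt_ones_true (by omega), vineLeaf_last_true, actsTo_p (by omega),
        Nat.mod_self, actsTo_p (by omega), Nat.mod_eq_of_lt (by omega)]

open MulOpposite in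
theorem op_p_eq (n : ℕ) :
    (op (p n) : HomeoR) = op (xAt (ones n)) * op (p (n + 1)) := by
  refine homeoR_ext_vine (n + 1) fun i hi η => ?_
  change (p n _) = p (n + 1) (xAt (ones n) _)
  rw [actsTo_p hi]
  rcases lt_trichotomy i n with h' | rfl | h'
  · rw [actsTo_xAt_ones_lt (by omega) h', actsTo_p (by omega), Nat.mod_eq_of_lt (by omega),
      Nat.mod_eq_of_lt (by omega), vineLeaf, vineLeaf, if_pos (by omega), if_pos (by omega)]
  · obtain ⟨b, η, rfl⟩ := exists_cons η
    have e (s : List Bool) : app s (cons b η) = app (s ++ [b]) η := by rw [app_append]; rfl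
    rw [e, e, Nat.mod_eq_of_lt (by omega)]
    cases b
    · rw [actsTo_xAt_ones_false (by omega), actsTo_p (by omega), vineLeaf_last_false,
        Nat.mod_eq_of_lt (by omega)]
    · rw [actsTo_xAt_ones_true (by omega), actsTo_p (by omega), vineLeaf_last_true,
        Nat.mod_eq_of_lt (by omega)]
  · obtain rfl : i = n + 1 := by omega
    rw [actsTo_xAt_ones_gt h', actsTo_p (by omega), Nat.mod_self, Nat.mod_self, vineLeaf_zero,
      vineLeaf_zero]

theorem lift_eq_of_relation {u v : FreeGroup Gen} (h : Relation u v) :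
    FreeGroup.lift Gen.toHomeo u = FreeGroup.lift Gen.toHomeo v := by
  cases h with
  | x_sq s =>
    simp only [X, map_mul, map_pow, FreeGroup.lift_apply_of, Gen.toHomeo]
    -- The relation is checked at the root only; localization, being a homomorphism, transports it
    -- to `s`.
    simpa [localizeHom_xAt] using congrArg (localizeHom s) op_x_sq
  | x_x s t u h =>
    simp only [X, map_mul, FreeGroup.lift_apply_of, Gen.toHomeo]
    exact op_comm_of_actsTo h x
  | x_p_x m n h =>
    simp only [X, P, map_mul, map_inv, FreeGroup.lift_apply_of, Gen.toHomeo]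
    rw [mul_assoc, op_p_mul_x m n h, inv_mul_cancel_left]
  | p_x n =>
    simp only [X, P, map_mul, map_pow, FreeGroup.lift_apply_of, Gen.toHomeo]
    exact op_p_mul_x_nil n
  | p_eq n =>
    simp only [X, P, map_mul, FreeGroup.lift_apply_of, Gen.toHomeo]
    exact op_p_eq n
  | p_pow n =>
    simp only [P, map_pow, map_one, FreeGroup.lift_apply_of, Gen.toHomeo]
    exact op_p_pow n
  | y_expand s =>
    simp only [X, Y, map_mul, map_inv, FreeGroup.lift_apply_of, Gen.toHomeo]
    have := congrArg (localizeHom s) op_y_expand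
    simpa only [map_mul, map_inv, localizeHom_xAt, localizeHom_yAt, List.append_nil] using this
  | y_x s t u h =>
    simp only [X, Y, map_mul, FreeGroup.lift_apply_of, Gen.toHomeo]
    exact op_comm_of_actsTo h y
  | y_p s n u h =>
    simp only [P, Y, map_mul, FreeGroup.lift_apply_of, Gen.toHomeo]
    exact op_comm_of_actsTo h y
  | y_y s t h =>
    simp only [Y, map_mul, FreeGroup.lift_apply_of, Gen.toHomeo]
    exact op_comm_of_actsTo (ActsTo.localize_of_independent h y) y

/-- The presented group. -/
abbrev Pres : Type := PresentedGroup relators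

/-- The homomorphism from the presented group to the homeomorphisms. -/
def toHomeo : Pres →* HomeoR :=
  PresentedGroup.toGroup (f := Gen.toHomeo) (by
    rintro r ⟨u, v, h, rfl⟩
    rw [map_mul, map_inv, lift_eq_of_relation h, mul_inv_cancel])

/-- The generator `x_s` of the presented group. -/
def gx (s : List Bool) : Pres := PresentedGroup.of (.x s)

/-- The generator `y_s` of the presented group. -/
def gy (s : List Bool) : Pres := PresentedGroup.of (.y s)

/-- The generator `p_n` of the presented group. -/
def gp (n : ℕ) : Pres := PresentedGroup.of (.p n)

theorem toHomeo_gx (s : List Bool) : toHomeo (gx s) = MulOpposite.op (xAt s) :=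
  PresentedGroup.toGroup.of _
theorem toHomeo_gy (s : List Bool) : toHomeo (gy s) = MulOpposite.op (yAt s) :=
  PresentedGroup.toGroup.of _
theorem toHomeo_gp (n : ℕ) : toHomeo (gp n) = MulOpposite.op (p n) :=
  PresentedGroup.toGroup.of _

/-! ### The relations inside the presented group -/

theorem mk_eq_of_relation {u v : FreeGroup Gen} (h : Relation u v) :
    PresentedGroup.mk relators u = PresentedGroup.mk relators v :=
  PresentedGroup.mk_eq_mk_of_mul_inv_mem ⟨u, v, h, rfl⟩

theorem gx_sq (s : List Bool) : gx s * gx s = gx (s ++ [false]) * gx s * gx (s ++ [true]) := by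
  rw [← sq]; exact mk_eq_of_relation (.x_sq s)
theorem gx_gx {s t u : List Bool} (h : ActsTo (xAt t) s u) : gx s * gx t = gx t * gx u :=
  mk_eq_of_relation (.x_x s t u h)
theorem gp_gx {m n : ℕ} (h : m < n) : gp n * gx (ones (m + 1)) = gx (ones m) * gp (n + 1) := by
  have h' : (gx (ones m))⁻¹ * gp n * gx (ones (m + 1)) = gp (n + 1) :=
    mk_eq_of_relation (.x_p_x m n h)
  rw [← h']; group
theorem gp_gx_nil (n : ℕ) : gp n * gx [] = gp (n + 1) ^ 2 := mk_eq_of_relation (.p_x n)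
theorem gp_eq (n : ℕ) : gp n = gx (ones n) * gp (n + 1) := mk_eq_of_relation (.p_eq n)
theorem gp_pow (n : ℕ) : gp n ^ (n + 2) = 1 := mk_eq_of_relation (.p_pow n)
theorem gy_expand (s : List Bool) : gy s = gx s * gy (s ++ [false]) *
    (gy (s ++ [true, false]))⁻¹ * gy (s ++ [true, true]) := mk_eq_of_relation (.y_expand s)
theorem gy_gx {s t u : List Bool} (h : ActsTo (xAt t) s u) : gy s * gx t = gx t * gy u :=
  mk_eq_of_relation (.y_x s t u h)
theorem gy_gp {s u : List Bool} {n : ℕ} (h : ActsTo (p n) s u) : gy s * gp n = gp n * gy u :=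
  mk_eq_of_relation (.y_p s n u h)
theorem gy_gy {s t : List Bool} (h : Independent s t) : gy s * gy t = gy t * gy s :=
  mk_eq_of_relation (.y_y s t h)

/-- The right action of the presented group on the Cantor set. -/
def act (g : Pres) (ξ : BinSeq) : BinSeq := (toHomeo g).unop ξ

theorem act_mul (g h : Pres) (ξ : BinSeq) : act (g * h) ξ = act h (act g ξ) := by
  unfold act; rw [map_mul]; rfl
theorem act_one (ξ : BinSeq) : act 1 ξ = ξ := by
  unfold act; rw [map_one]; rfl
theorem act_injective (g : Pres) : Function.Injective (act g) := (toHomeo g).unop.injective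
theorem act_inv_act (g : Pres) (ξ : BinSeq) : act g⁻¹ (act g ξ) = ξ := by
  rw [← act_mul, mul_inv_cancel, act_one]
theorem act_gx (s : List Bool) (ξ : BinSeq) : act (gx s) ξ = xAt s ξ := by
  unfold act; rw [toHomeo_gx]; rfl
theorem act_gy (s : List Bool) (ξ : BinSeq) : act (gy s) ξ = yAt s ξ := by
  unfold act; rw [toHomeo_gy]; rfl


/-! ### Finite binary trees and Thompson's group `T` -/

/-- Finite binary trees. -/
inductive Shape : Type
  | leaf
  | node (l r : Shape)

namespace Shape

/-- The number of leaves. -/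
def size : Shape → ℕ
  | leaf => 1
  | node l r => size l + size r

/-- The number of leaves of the left subtree. -/
def leftSize : Shape → ℕ
  | leaf => 0
  | node l _ => size l

/-- The address of the `i`-th leaf. -/
def leafAt : Shape → ℕ → List Bool
  | leaf, _ => []
  | node l r, i => if i < size l then false :: leafAt l i else true :: leafAt r (i - size l)

/-- Replace the `i`-th leaf by a caret. -/
def addCaret : Shape → ℕ → Shape
  | leaf, _ => node leaf leaf
  | node l r, i =>
      if i < size l then node (addCaret l i) r else node l (addCaret r (i - size l))

theorem size_node (l r : Shape) : size (node l r) = size l + size r := rfl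

theorem leafAt_left {l : Shape} {i : ℕ} (h : i < size l) (r : Shape) :
    leafAt (node l r) i = false :: leafAt l i := if_pos h

theorem leafAt_right {l : Shape} {i : ℕ} (h : ¬ i < size l) (r : Shape) :
    leafAt (node l r) i = true :: leafAt r (i - size l) := if_neg h

theorem addCaret_left {l : Shape} {i : ℕ} (h : i < size l) (r : Shape) :
    addCaret (node l r) i = node (addCaret l i) r := if_pos h

theorem addCaret_right {l : Shape} {i : ℕ} (h : ¬ i < size l) (r : Shape) :
    addCaret (node l r) i = node l (addCaret r (i - size l)) := if_neg h

theorem size_pos : ∀ D : Shape, 0 < size D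
  | leaf => Nat.one_pos
  | node l _ => Nat.add_pos_left (size_pos l) _

theorem size_addCaret (D : Shape) (i : ℕ) : size (addCaret D i) = size D + 1 := by
  induction D generalizing i with
  | leaf => rfl
  | node l r hl hr =>
    unfold addCaret
    split
    · rw [size, hl, size]; omega
    · rw [size, hr, size]; omega

/-- `Rot t D D'` means that `D'` arises from `D` by a rotation at the vertex `t`. -/
inductive Rot : List Bool → Shape → Shape → Prop
  | here (a b c : Shape) : Rot [] (node (node a b) c) (node a (node b c))
  | left {t : List Bool} {l l' : Shape} (r : Shape) (_ : Rot t l l') :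
      Rot (false :: t) (node l r) (node l' r)
  | right {t : List Bool} {r r' : Shape} (l : Shape) (_ : Rot t r r') :
      Rot (true :: t) (node l r) (node l r')

theorem Rot.size_eq {t : List Bool} {D D' : Shape} (h : Rot t D D') : size D = size D' := by
  induction h with
  | here => simp only [size]; omega
  | left _ _ ih => simp only [size, ih]
  | right _ _ ih => simp only [size, ih]

/-- The bound on the size guarantees that `size D - 2` is a true subtraction when the pair is used
to represent `x_t`. -/
theorem exists_rot (t : List Bool) : ∃ D D', Rot t D D' ∧ 2 ≤ size D := by
  induction t with
  | nil => exact ⟨_, _, .here leaf leaf leaf, by simp [size]⟩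
  | cons b t ih =>
    obtain ⟨D, D', h, hs⟩ := ih
    cases b
    · exact ⟨_, _, .left leaf h, by simp only [size]; omega⟩
    · exact ⟨_, _, .right leaf h, by simp only [size]; omega⟩

/-- `Expands D C` means that `C` arises from `D` by adding carets. -/
def Expands : Shape → Shape → Prop :=
  Relation.ReflTransGen fun D C => ∃ i < size D, C = addCaret D i

theorem Expands.node_left {l l' : Shape} (h : Expands l l') (r : Shape) :
    Expands (node l r) (node l' r) := by
  refine Relation.ReflTransGen.lift (node · r) ?_ l l' h
  rintro D _ ⟨i, hi, rfl⟩
  exact ⟨i, by simp only [size]; omega, by rw [addCaret, if_pos hi]⟩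

theorem Expands.node_right {r r' : Shape} (h : Expands r r') (l : Shape) :
    Expands (node l r) (node l r') := by
  refine Relation.ReflTransGen.lift (node l ·) ?_ r r' h
  rintro D _ ⟨i, hi, rfl⟩
  exact ⟨size l + i, by simp only [size]; omega, by
    rw [addCaret, if_neg (by omega), Nat.add_sub_cancel_left]⟩

/-- The full binary tree of a given height. -/
def full : ℕ → Shape
  | 0 => leaf
  | n + 1 => node (full n) (full n)

/-- All large heights are needed, not just one, because both subtrees must reach the same height. -/
theorem expands_full_of_le (D : Shape) : ∃ N, ∀ n, N ≤ n → Expands D (full n) := by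
  induction D with
  | leaf =>
    refine ⟨0, fun n _ => ?_⟩
    induction n with
    | zero => exact Relation.ReflTransGen.refl
    | succ n ih =>
      refine Relation.ReflTransGen.head (b := node leaf leaf) ⟨0, Nat.one_pos, rfl⟩ ?_
      exact (ih n.zero_le |>.node_left leaf).trans (ih n.zero_le |>.node_right (full n))
  | node l r hl hr =>
    obtain ⟨N, hN⟩ := hl
    obtain ⟨M, hM⟩ := hr
    refine ⟨N + M + 1, fun n hn => ?_⟩
    obtain ⟨n, rfl⟩ : ∃ k, n = k + 1 := ⟨n - 1, by omega⟩
    exact ((hN n (by omega)).node_left r).trans ((hM n (by omega)).node_right (full n))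

theorem exists_common_expansion (D E : Shape) : ∃ C, Expands D C ∧ Expands E C := by
  obtain ⟨N, hN⟩ := expands_full_of_le D
  obtain ⟨M, hM⟩ := expands_full_of_le E
  exact ⟨full (N + M), hN _ (by omega), hM _ (by omega)⟩

theorem leafAt_zero (D : Shape) : ∃ k, leafAt D 0 = List.replicate k false := by
  induction D with
  | leaf => exact ⟨0, rfl⟩
  | node l r hl _ =>
    obtain ⟨k, hk⟩ := hl
    exact ⟨k + 1, by rw [leafAt, if_pos (size_pos l), hk]; rfl⟩

theorem eq_zero_of_leafAt_eq {D : Shape} {i k : ℕ} (hi : i < size D)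
    (h : leafAt D i = List.replicate k false) : i = 0 := by
  induction D generalizing i k with
  | leaf => exact Nat.lt_one_iff.1 hi
  | node l r hl _ =>
    unfold leafAt at h
    cases k with
    | zero => split at h <;> simp at h
    | succ k =>
      split at h
      · exact hl ‹_› (List.cons.inj h).2
      · simp [List.replicate_succ] at h

/-- The first digit of the addresses tells where the left subtree ends, so the left sizes agree and
both subtrees can be compared recursively. -/
theorem eq_of_leafAt_eq {D E : Shape} (hs : size D = size E)
    (h : ∀ i < size D, leafAt D i = leafAt E i) : D = E := by
  induction D generalizing E with
  | leaf =>
    cases E with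
    | leaf => rfl
    | node l r =>
      have := size_pos l
      have := size_pos r
      simp only [size] at hs
      omega
  | node l r hl hr =>
    cases E with
    | leaf =>
      have := size_pos l
      have := size_pos r
      simp only [size] at hs
      omega
    | node l' r' =>
      simp only [size] at hs h
      have h1 : size l = size l' := by
        rcases lt_trichotomy (size l) (size l') with h1 | h1 | h1
        · have := h (size l) (by have := size_pos r; omega)
          simp [leafAt, h1] at this
        · exact h1
        · have := h (size l') (by omega)
          simp [leafAt, h1] at this
      have h2 : l = l' := hl h1 fun i hi => by
        have := h i (by omega)
        rw [leafAt_left hi, leafAt_left (by omega)] at this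
        exact (List.cons.inj this).2
      have h3 : r = r' := hr (by omega) fun i hi => by
        have := h (size l + i) (by omega)
        rw [leafAt_right (by omega), leafAt_right (by omega), ← h1, Nat.add_sub_cancel_left] at this
        exact (List.cons.inj this).2
      rw [h2, h3]

end Shape

open Shape

/-- The element that carries a tree, hanging at the vertex `s`, to the right vine. -/
def toVine : List Bool → Shape → Pres
  | _, leaf => 1
  | s, node leaf r => toVine (s ++ [true]) r
  | s, node (node a b) c => gx s * toVine s (node a (node b c))
-- A rotation at the root keeps the number of leaves and makes the left subtree smaller.
termination_by _ D => (size D, leftSize D)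
decreasing_by
  · simp only [size, Prod.lex_def]; omega
  · have := size_pos b
    simp only [size, leftSize, Prod.lex_def]; omega

theorem toVine_leaf (s : List Bool) : toVine s leaf = 1 := by rw [toVine]
theorem toVine_node_leaf (s : List Bool) (r : Shape) :
    toVine s (node leaf r) = toVine (s ++ [true]) r := by rw [toVine]
theorem toVine_node_node (s : List Bool) (a b c : Shape) :
    toVine s (node (node a b) c) = gx s * toVine s (node a (node b c)) := by rw [toVine]

theorem toVine_mul_gx {s u t : List Bool} (D : Shape)
    (h : ∀ w, gx (s ++ w) * gx t = gx t * gx (u ++ w)) :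
    toVine s D * gx t = gx t * toVine u D := by
  induction s, D using toVine.induct generalizing u with
  | case1 s => rw [toVine_leaf, toVine_leaf, one_mul, mul_one]
  | case2 s r ih =>
    rw [toVine_node_leaf, toVine_node_leaf]
    refine ih fun w => ?_
    rw [List.append_assoc, List.append_assoc]
    exact h _
  | case3 s a b c ih =>
    have h0 := h []
    rw [List.append_nil, List.append_nil] at h0
    rw [toVine_node_node, toVine_node_node, mul_assoc, ih h, ← mul_assoc, h0, mul_assoc]

/-- The vertex where the vine with `n` leaves has to be rotated to absorb a caret at its `i`-th
leaf. -/
def vineCaret (s : List Bool) (n i : ℕ) : Pres := if i + 1 < n then gx (s ++ ones i) else 1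

/-- Rotating the old tree to the vine carries the new caret to the `i`-th vine leaf. One rotation at
`1ⁱ` absorbs it, unless that leaf is the last, where the result is already a vine. -/
theorem toVine_addCaret (s : List Bool) (D : Shape) {i : ℕ} (hi : i < size D) :
    toVine s (addCaret D i) = toVine s D * vineCaret s (size D) i := by
  induction s, D using toVine.induct generalizing i with
  | case1 s =>
    rw [addCaret, toVine_node_leaf, toVine_leaf, toVine_leaf, vineCaret, if_neg, mul_one]
    simp [size]
  | case2 s r ih =>
    simp only [size] at hi ⊢
    rcases i with _ | i
    · have := size_pos r
      rw [addCaret_left (l := leaf) Nat.one_pos, addCaret, toVine_node_node, toVine_node_leaf,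
        toVine_node_leaf, toVine_node_leaf, vineCaret, if_pos (by omega)]
      have e : s ++ ones 0 = s := List.append_nil s
      rw [e]
      refine (toVine_mul_gx r fun w => gx_gx ?_).symm
      simpa using actsTo_xAt_1 s w
    · rw [addCaret, if_neg (by simp [size]), toVine_node_leaf, toVine_node_leaf, size,
        Nat.add_sub_cancel, ih (by omega), vineCaret, vineCaret]
      congr 1
      have e : s ++ [true] ++ ones i = s ++ ones (i + 1) := by simp [ones_succ]
      rw [e]
      exact if_congr (by omega) rfl rfl
  | case3 s a b c ih =>
    simp only [size] at hi ih ⊢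
    rw [toVine_node_node, mul_assoc, Nat.add_assoc, ← ih (by omega)]
    by_cases h1 : i < size a
    · rw [addCaret_left (by rw [size_node]; omega), addCaret_left h1, addCaret_left h1,
        toVine_node_node]
    · by_cases h2 : i < size a + size b
      · rw [addCaret_left h2, addCaret_right h1, addCaret_right h1, addCaret_left (by omega),
          toVine_node_node]
      · rw [addCaret_right h2, addCaret_right h1, addCaret_right (by omega), toVine_node_node,
          size_node, Nat.sub_sub]

/-- The path to the vine does not depend on the rotation chosen first. A rotation deeper in one of
the three subtrees `a`, `b`, `c` passes through the root rotation by `x_x`; a rotation at the left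
child of the root gives a pentagon, which is exactly `x_sq`. -/
theorem toVine_rot (s : List Bool) {t : List Bool} {D D' : Shape} (h : Rot t D D') :
    toVine s D = gx (s ++ t) * toVine s D' := by
  match D, h with
  | node leaf r, .right _ h =>
    rw [toVine_node_leaf, toVine_node_leaf, toVine_rot (s ++ [true]) h]
    simp
  | node (node a b) c, .here _ _ _ => rw [toVine_node_node, List.append_nil]
  | node (node a b) c, .right (t := t) (r' := c') _ h =>
    rw [toVine_node_node, toVine_node_node,
      toVine_rot s (D := node a (node b c)) (.right _ (.right _ h)), ← mul_assoc, ← mul_assoc,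
      gx_gx (actsTo_xAt_1 s t)]
  | node (node a b) c, .left _ (.left (t := t) _ h) =>
    rw [toVine_node_node, toVine_node_node,
      toVine_rot s (D := node a (node b c)) (.left _ h), ← mul_assoc, ← mul_assoc,
      gx_gx (actsTo_xAt_00 s t)]
  | node (node a b) c, .left _ (.right (t := t) _ h) =>
    rw [toVine_node_node, toVine_node_node,
      toVine_rot s (D := node a (node b c)) (.right _ (.left _ h)), ← mul_assoc, ← mul_assoc,
      gx_gx (actsTo_xAt_01 s t)]
  | node (node (node a₁ a₂) b) c, .left _ (.here _ _ _) =>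
    rw [toVine_node_node, toVine_node_node, toVine_node_node,
      toVine_rot s (D := node a₁ (node (node a₂ b) c)) (.right _ (.here _ _ _)), ← mul_assoc,
      ← mul_assoc, ← mul_assoc, gx_sq]
termination_by (size D, leftSize D)
decreasing_by
  · simp only [size, Prod.lex_def]; omega
  all_goals
    have := size_pos b
    try have := size_pos a₂
    simp only [size, leftSize, Prod.lex_def]; omega

/-! ### Normal forms in `T` -/

/-- The three cases are the relations `x_p_x`, `p_eq` and `p_x`. If the caret wraps around from the
last leaf to the first, both of its leaves do, which gives the exponent 2 in place of 1. -/
theorem gp_mul_vineCaret (m : ℕ) {i : ℕ} (hi : i < m + 2) :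
    ∃ j, gp m * vineCaret [] (m + 2) ((i + 1) % (m + 2)) =
      vineCaret [] (m + 2) i * gp (m + 1) ^ j := by
  unfold vineCaret
  rcases (show i < m ∨ i = m ∨ i = m + 1 by omega) with h | rfl | rfl
  · refine ⟨1, ?_⟩
    rw [Nat.mod_eq_of_lt (by omega), if_pos (by omega), if_pos (by omega), pow_one]
    exact gp_gx h
  · refine ⟨1, ?_⟩
    rw [Nat.mod_eq_of_lt (by omega), if_neg (by omega), if_pos (by omega), pow_one, mul_one]
    exact gp_eq i
  · refine ⟨2, ?_⟩
    rw [Nat.mod_self, if_pos (by omega), if_neg (by omega), one_mul]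
    exact gp_gx_nil m

theorem gp_pow_mul_vineCaret (m j : ℕ) {i : ℕ} (hi : i < m + 2) :
    ∃ k, gp m ^ j * vineCaret [] (m + 2) ((i + j) % (m + 2)) =
      vineCaret [] (m + 2) i * gp (m + 1) ^ k := by
  induction j with
  | zero => exact ⟨0, by simp [Nat.mod_eq_of_lt hi]⟩
  | succ j ih =>
    obtain ⟨k, hk⟩ := ih
    obtain ⟨l, hl⟩ := gp_mul_vineCaret m (Nat.mod_lt (i + j) (show m + 2 > 0 by omega))
    refine ⟨k + l, ?_⟩
    rw [Nat.mod_add_mod] at hl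
    rw [← Nat.add_assoc, pow_succ, mul_assoc, hl, ← mul_assoc, hk, mul_assoc, ← pow_add]

/-- `g` is represented by the pair of trees `(D, E)` and a rotation of their leaves. -/
def IsTreePair (g : Pres) (D E : Shape) : Prop :=
  ∃ m j, size D = m + 2 ∧ size E = m + 2 ∧ g = toVine [] D * gp m ^ j * (toVine [] E)⁻¹

theorem IsTreePair.inv {g : Pres} {D E : Shape} (h : IsTreePair g D E) : IsTreePair g⁻¹ E D := by
  obtain ⟨m, j, hD, hE, rfl⟩ := h
  -- Since `p_m` has order dividing `m + 2`, the exponent `j * (m + 1)` represents `-j`.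
  refine ⟨m, j * (m + 1), hE, hD, ?_⟩
  have h1 : (gp m ^ j)⁻¹ = gp m ^ (j * (m + 1)) := by
    rw [inv_eq_iff_mul_eq_one, ← pow_add, show j + j * (m + 1) = (m + 2) * j by ring, pow_mul,
      gp_pow, one_pow]
  rw [← h1]
  group

theorem IsTreePair.expand {g : Pres} {D E C : Shape} (h : IsTreePair g D E) (hC : Expands E C) :
    ∃ D', IsTreePair g D' C := by
  induction hC with
  | refl => exact ⟨D, h⟩
  | tail _ hk ih =>
    clear h
    obtain ⟨D, m, j, hD, hE, rfl⟩ := ih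
    obtain ⟨k, hk, rfl⟩ := hk
    rename_i E _
    obtain ⟨i, hi, hik⟩ : ∃ i < m + 2, (i + j) % (m + 2) = k := by
      -- This is `k - j` modulo `m + 2`: the leaf of `D` that the shift sends to the `k`-th leaf of
      -- `E`.
      refine ⟨(k + (m + 1) * j) % (m + 2), Nat.mod_lt _ (by omega), ?_⟩
      rw [Nat.mod_add_mod, show k + (m + 1) * j + j = k + (m + 2) * j by ring,
        Nat.add_mul_mod_self_left, Nat.mod_eq_of_lt (by omega)]
    obtain ⟨l, hl⟩ := gp_pow_mul_vineCaret m j hi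
    rw [hik] at hl
    refine ⟨addCaret D i, m + 1, l, by rw [size_addCaret, hD], by rw [size_addCaret, hE], ?_⟩
    rw [toVine_addCaret [] D (by omega), toVine_addCaret [] E hk, hD, hE, mul_assoc _ _ (gp _ ^ l),
      ← hl]
    group

/-- After expansion to a common middle tree, the inner factors `toVine` cancel and the two shifts
add up. -/
theorem IsTreePair.mul {g h : Pres} {D E D' E' : Shape} (hg : IsTreePair g D E)
    (hh : IsTreePair h D' E') : ∃ A B, IsTreePair (g * h) A B := by
  obtain ⟨C, h1, h2⟩ := exists_common_expansion E D'
  obtain ⟨A, m, j, hA, hC, rfl⟩ := hg.expand h1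
  obtain ⟨B, hB'⟩ := hh.inv.expand h2
  obtain ⟨n, k, hC', hB, rfl⟩ : IsTreePair h C B := by simpa using hB'.inv
  obtain rfl : m = n := by omega
  refine ⟨A, B, m, j + k, hA, hB, ?_⟩
  rw [pow_add]
  group

/-- The subgroup of the presented group that is generated by all `x_s` and `p_n`. -/
def presT : Subgroup Pres := Subgroup.closure (Set.range gx ∪ Set.range gp)

theorem gx_mem_presT (s : List Bool) : gx s ∈ presT :=
  Subgroup.subset_closure (Or.inl ⟨s, rfl⟩)

theorem gp_mem_presT (n : ℕ) : gp n ∈ presT :=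
  Subgroup.subset_closure (Or.inr ⟨n, rfl⟩)

/-- The right vine with `n + 2` leaves. -/
def vine : ℕ → Shape
  | 0 => node leaf leaf
  | n + 1 => node leaf (vine n)

theorem size_vine (n : ℕ) : size (vine n) = n + 2 := by
  induction n with
  | zero => rfl
  | succ n ih => rw [vine, size, ih, size]; omega

theorem toVine_vine (s : List Bool) (n : ℕ) : toVine s (vine n) = 1 := by
  induction n generalizing s with
  | zero => rw [vine, toVine_node_leaf, toVine_leaf]
  | succ n ih => rw [vine, toVine_node_leaf, ih]

theorem exists_isTreePair {g : Pres} (hg : g ∈ presT) : ∃ D E, IsTreePair g D E := by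
  induction hg using Subgroup.closure_induction with
  | mem g hg =>
    rcases hg with ⟨s, rfl⟩ | ⟨n, rfl⟩
    · obtain ⟨D, E, h, hs⟩ := exists_rot s
      -- By `toVine_rot`, `x_s` is the quotient of the `toVine` elements of two trees that differ by
      -- a rotation at `s`; the shift is zero.
      refine ⟨D, E, size D - 2, 0, by omega, by rw [← h.size_eq]; omega, ?_⟩
      rw [toVine_rot [] h]
      simp
    · refine ⟨vine n, vine n, n, 1, size_vine n, size_vine n, ?_⟩
      rw [toVine_vine]
      simp
  | one => exact ⟨vine 0, vine 0, 0, 0, rfl, rfl, by simp⟩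
  | mul g h _ _ hg hh =>
    obtain ⟨_, _, hg⟩ := hg
    obtain ⟨_, _, hh⟩ := hh
    exact hg.mul hh
  | inv g _ hg =>
    obtain ⟨D, E, hg⟩ := hg
    exact ⟨E, D, hg.inv⟩

/-! ### Faithfulness of the action of the subgroup generated by `x` and `p` -/

theorem Independent.append_left {u s : List Bool} (h : Independent u s) (w : List Bool) :
    Independent u (s ++ w) :=
  ⟨fun h' => (List.prefix_or_prefix_of_prefix h' (List.prefix_append s w)).elim h.1 h.2,
    fun h' => h.2 ((List.prefix_append s w).trans h')⟩

theorem act_gx_of_independent {u s : List Bool} (h : Independent u s) (η : BinSeq) :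
    act (gx s) (app u η) = app u η := by
  rw [act_gx]
  exact ActsTo.localize_of_independent h x η

theorem act_toVine_of_independent {u s : List Bool} (D : Shape) (h : Independent u s)
    (η : BinSeq) : act (toVine s D) (app u η) = app u η := by
  induction s, D using toVine.induct with
  | case1 s => rw [toVine_leaf, act_one]
  | case2 s r ih => rw [toVine_node_leaf, ih (h.append_left _)]
  | case3 s a b c ih => rw [toVine_node_node, act_mul, act_gx_of_independent h, ih h]

theorem act_toVine (s : List Bool) (D : Shape) {i : ℕ} (hi : i < size D) (η : BinSeq) :
    act (toVine s D) (app (s ++ leafAt D i) η) = app (s ++ vineLeaf (size D) i) η := by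
  induction s, D using toVine.induct generalizing i with
  | case1 s =>
    obtain rfl : i = 0 := Nat.lt_one_iff.1 hi
    rw [toVine_leaf, act_one]; rfl
  | case2 s r ih =>
    simp only [size] at hi ⊢
    rw [toVine_node_leaf, leafAt]
    rcases i with _ | i
    · obtain ⟨k, hk⟩ : ∃ k, 1 + size r = k + 2 := ⟨size r - 1, by have := size_pos r; omega⟩
      rw [if_pos (by simp [size]), leafAt, hk, vineLeaf_zero]
      exact act_toVine_of_independent r (independent_append s (by simp) [] []) η
    · have := ih (i := i) (by omega)
      rw [if_neg (by simp [size]), size, Nat.add_sub_cancel, Nat.add_comm 1, vineLeaf_succ]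
      simpa using this
  | case3 s a b c ih =>
    simp only [size] at hi ih ⊢
    rw [toVine_node_node, act_mul, act_gx, Nat.add_assoc, ← ih (by omega)]
    by_cases h1 : i < size a
    · rw [leafAt_left (by rw [size_node]; omega), leafAt_left h1, leafAt_left h1, actsTo_xAt_00]
    · by_cases h2 : i < size a + size b
      · rw [leafAt_left h2, leafAt_right h1, leafAt_right h1, leafAt_left (by omega),
          actsTo_xAt_01]
      · rw [leafAt_right h2, leafAt_right h1, leafAt_right (by omega), actsTo_xAt_1, size_node,
          Nat.sub_sub]

/-- Both constants are needed: a single one cannot see how often its digit is repeated at the end of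
the prefix. -/
theorem eq_of_app_const_eq {s t : List Bool}
    (h : ∀ b, app s (fun _ => b) = app t fun _ => b) : s = t := by
  induction s generalizing t with
  | nil =>
    cases t with
    | nil => rfl
    | cons b t =>
      have := congrFun (h !b) 0
      cases b <;> exact absurd this (by simp [app, cons])
  | cons a s ih =>
    cases t with
    | nil =>
      have := congrFun (h !a) 0
      cases a <;> exact absurd this (by simp [app, cons])
    | cons b t =>
      obtain ⟨rfl, -⟩ := cons_injective2 (h true)
      rw [ih fun b => (cons_injective2 (h b)).2]

/-- The group generated by all `x_s` and `p_n` acts faithfully. -/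
theorem eq_one_of_mem_presT {g : Pres} (hg : g ∈ presT) (h : ∀ ξ, act g ξ = ξ) : g = 1 := by
  obtain ⟨D, E, m, j, hD, hE, rfl⟩ := exists_isTreePair hg
  -- The cone at the `i`-th leaf of `D` goes to a vine cone, is shifted by `j`, and goes to a leaf
  -- of `E`; as the action is trivial, the two addresses agree.
  have key (i : ℕ) (hi : i < m + 2) : leafAt D i = leafAt E ((i + j) % (m + 2)) := by
    refine eq_of_app_const_eq fun b => ?_
    generalize (fun _ => b : BinSeq) = η
    have hlt : (i + j) % (m + 2) < m + 2 := Nat.mod_lt _ (by omega)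
    refine act_injective (toVine [] E) ?_
    have h1 := act_toVine [] E (hE ▸ hlt) η
    have h2 := act_toVine [] D (hD ▸ hi) η
    rw [List.nil_append, List.nil_append, hE] at h1
    rw [List.nil_append, List.nil_append, hD] at h2
    have h3 : act (gp m ^ j) (app (vineLeaf (m + 2) i) η) =
        app (vineLeaf (m + 2) ((i + j) % (m + 2))) η := by
      unfold act
      rw [map_pow, toHomeo_gp, op_p_pow_apply m i j hi]
    rw [h1, ← h3, ← h2, ← act_mul, ← h (app (leafAt D i) η), ← act_mul, h]
    group
  obtain ⟨k, hk⟩ := leafAt_zero D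
  -- The first leaf of `D` has an address consisting of zeros, and only the first leaf of `E` has
  -- such an address.
  have hj : j % (m + 2) = 0 := by
    have h0 := key 0 (by omega)
    rw [hk, Nat.zero_add] at h0
    exact eq_zero_of_leafAt_eq (hE ▸ Nat.mod_lt _ (by omega)) h0.symm
  obtain ⟨l, rfl⟩ := Nat.dvd_of_mod_eq_zero hj
  obtain rfl : D = E := eq_of_leafAt_eq (by omega) fun i hi => by
    rw [key i (by omega), Nat.add_mul_mod_self_left, Nat.mod_eq_of_lt (by omega)]
  rw [pow_mul, gp_pow, one_pow, mul_one, mul_inv_cancel]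


/-! ### The subgroups that are supported in a cone -/

/-- The subgroup generated by the `x_u` where `u` extends `s`. -/
def coneF (s : List Bool) : Subgroup Pres := Subgroup.closure (Set.range fun w => gx (s ++ w))

/-- The subgroup generated by the `x_u` and `y_u` where `u` extends `s`. -/
def coneG (s : List Bool) : Subgroup Pres :=
  Subgroup.closure ((Set.range fun w => gx (s ++ w)) ∪ Set.range fun w => gy (s ++ w))

theorem gx_append_mem_coneF (s w : List Bool) : gx (s ++ w) ∈ coneF s :=
  Subgroup.subset_closure ⟨w, rfl⟩

theorem gx_mem_coneF (s : List Bool) : gx s ∈ coneF s := by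
  simpa using gx_append_mem_coneF s []

theorem gx_append_mem_coneG (s w : List Bool) : gx (s ++ w) ∈ coneG s :=
  Subgroup.subset_closure (Or.inl ⟨w, rfl⟩)

theorem gy_append_mem_coneG (s w : List Bool) : gy (s ++ w) ∈ coneG s :=
  Subgroup.subset_closure (Or.inr ⟨w, rfl⟩)

theorem gy_mem_coneG (s : List Bool) : gy s ∈ coneG s := by
  simpa using gy_append_mem_coneG s []

theorem coneF_le_coneG (s : List Bool) : coneF s ≤ coneG s :=
  Subgroup.closure_mono Set.subset_union_left

theorem coneF_append_le (s w : List Bool) : coneF (s ++ w) ≤ coneF s := by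
  refine (Subgroup.closure_le _).2 ?_
  rintro _ ⟨v, rfl⟩
  simp only [List.append_assoc]
  exact gx_append_mem_coneF s _

theorem coneG_append_le (s w : List Bool) : coneG (s ++ w) ≤ coneG s := by
  refine (Subgroup.closure_le _).2 ?_
  rintro _ (⟨v, rfl⟩ | ⟨v, rfl⟩) <;> simp only [List.append_assoc]
  · exact gx_append_mem_coneG s _
  · exact gy_append_mem_coneG s _

theorem coneF_le_presT (s : List Bool) : coneF s ≤ presT := by
  refine (Subgroup.closure_le _).2 ?_
  rintro _ ⟨w, rfl⟩
  exact gx_mem_presT _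

theorem Independent.append {s t : List Bool} (h : Independent s t) (v w : List Bool) :
    Independent (s ++ v) (t ++ w) :=
  (h.append_left w).symm.append_left v |>.symm

/-- For independent addresses, `x` at either one fixes the other, so `x_x`, `y_x` and `y_y` make the
generators commute. -/
theorem commute_of_independent {s t : List Bool} (h : Independent s t) {g k : Pres}
    (hg : g ∈ coneG s) (hk : k ∈ coneG t) : Commute g k := by
  have hx {u v : List Bool} (h : Independent u v) : ActsTo (xAt v) u u :=
    ActsTo.localize_of_independent h x
  have key : coneG s ≤ Subgroup.centralizer (coneG t : Set Pres) := by
    rw [coneG, coneG, Subgroup.closure_le, Subgroup.centralizer_closure]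
    rintro _ (⟨v, rfl⟩ | ⟨v, rfl⟩) <;> rw [SetLike.mem_coe, Subgroup.mem_centralizer_iff] <;>
      rintro _ (⟨w, rfl⟩ | ⟨w, rfl⟩)
    · exact (gx_gx (hx (h.append v w))).symm
    · exact gy_gx (hx (h.append v w).symm)
    · exact (gy_gx (hx (h.append v w))).symm
    · exact (gy_gy (h.append v w)).symm
  exact (Subgroup.mem_centralizer_iff.1 (key hg) k hk).symm

/-! ### Labelled trees -/

/-- Finite binary trees whose interior vertices carry exponents of `y`. -/
inductive YTree : Type
  | leaf
  | node (k : ℤ) (l r : YTree)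

namespace YTree

/-- The product of the powers of `y` that a tree prescribes, deepest vertices first, where the
root of the tree is placed at `s`. -/
def eval : List Bool → YTree → Pres
  | _, leaf => 1
  | s, node k l r => eval (s ++ [false]) l * eval (s ++ [true]) r * gy s ^ k

/-- Change the exponent at the root. -/
def addRoot (e : ℤ) : YTree → YTree
  | leaf => node e leaf leaf
  | node k l r => node (k + e) l r

/-- The largest total of the absolute values of the exponents along a branch. -/
def weight : YTree → ℕ
  | leaf => 0
  | node k l r => k.natAbs + max (weight l) (weight r)

/-- All exponents are zero. -/
def IsZero : YTree → Prop
  | leaf => True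
  | node k l r => k = 0 ∧ IsZero l ∧ IsZero r

/-- The phases of the transducer for `y` and `y⁻¹`; `mid` is the phase of `y` after the
digit `0`, and of `y⁻¹` after the digit `1`. -/
inductive Phase : Type
  | pos
  | mid
  | neg

/-- The transducer reads a digit. -/
def Phase.step : Phase → Bool → Phase
  | pos, false => mid
  | mid, false => pos
  | neg, false => neg
  | pos, true => pos
  | mid, true => neg
  | neg, true => mid

/-- A transducer that enters the tree in the phase `σ` does not cancel with any of the topmost
nonzero exponents of the tree. -/
def Admits (σ : Phase) : YTree → Prop
  | leaf => True
  | node k l r => (0 < k → σ ≠ .neg) ∧ (k < 0 → σ ≠ .pos) ∧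
      (k = 0 → Admits (σ.step false) l ∧ Admits (σ.step true) r)

/-- There are no cancellations between consecutive exponents along any branch. -/
def Reduced : YTree → Prop
  | leaf => True
  | node k l r => Reduced l ∧ Reduced r ∧ (0 < k → Admits .mid l ∧ Admits .pos r) ∧
      (k < 0 → Admits .neg l ∧ Admits .mid r)

theorem eval_mem_coneG (s : List Bool) (t : YTree) : eval s t ∈ coneG s := by
  induction t generalizing s with
  | leaf => exact one_mem _
  | node k l r hl hr =>
    exact mul_mem (mul_mem (coneG_append_le _ _ (hl _)) (coneG_append_le _ _ (hr _)))
      (zpow_mem (gy_mem_coneG s) k)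

theorem eval_eq_one {t : YTree} (h : IsZero t) (s : List Bool) : eval s t = 1 := by
  induction t generalizing s with
  | leaf => rfl
  | node k l r hl hr =>
    obtain ⟨rfl, h1, h2⟩ := h
    rw [eval, hl h1, hr h2]; simp

theorem eval_addRoot (e : ℤ) (t : YTree) (s : List Bool) :
    eval s (addRoot e t) = eval s t * gy s ^ e := by
  cases t with
  | leaf => simp [addRoot, eval]
  | node k l r => simp [addRoot, eval, zpow_add, mul_assoc]

theorem eval_node_zero (s : List Bool) (l r : YTree) :
    eval s (node 0 l r) = eval (s ++ [false]) l * eval (s ++ [true]) r := by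
  rw [eval, zpow_zero, mul_one]

/-- Moving a tree to another vertex only requires that its letters `y` move; this applies to
conjugation by `x_s` and by `p_0`. -/
theorem eval_semiconj {g : Pres} {u v : List Bool}
    (h : ∀ w, SemiconjBy g (gy (u ++ w)) (gy (v ++ w))) (t : YTree) :
    SemiconjBy g (eval u t) (eval v t) := by
  induction t generalizing u v with
  | leaf => exact SemiconjBy.one_right g
  | node k l r hl hr =>
    refine ((hl fun w => ?_).mul_right (hr fun w => ?_)).mul_right (SemiconjBy.zpow_right ?_ k)
    · simpa using h (false :: w)
    · simpa using h (true :: w)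
    · simpa using h []

theorem eval_mul_gx {s u v : List Bool} (h : ∀ w, ActsTo (xAt s) (u ++ w) (v ++ w)) (t : YTree) :
    eval u t * gx s = gx s * eval v t :=
  (eval_semiconj (fun w => (gy_gx (h w)).symm) t).eq.symm

theorem eval_rotate (s : List Bool) (a b c : YTree) :
    eval (s ++ [false, false]) a * eval (s ++ [false, true]) b * eval (s ++ [true]) c * gx s =
      gx s * (eval (s ++ [false]) a * eval (s ++ [true, false]) b * eval (s ++ [true, true]) c) := by
  have h1 := eval_mul_gx (s := s) (u := s ++ [false, false]) (v := s ++ [false])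
    (fun w => by simpa using actsTo_xAt_00 s w) a
  have h2 := eval_mul_gx (s := s) (u := s ++ [false, true]) (v := s ++ [true, false])
    (fun w => by simpa using actsTo_xAt_01 s w) b
  have h3 := eval_mul_gx (s := s) (u := s ++ [true]) (v := s ++ [true, true])
    (fun w => by simpa using actsTo_xAt_1 s w) c
  rw [mul_assoc, h3, ← mul_assoc, mul_assoc (eval _ a), h2, ← mul_assoc, h1]
  simp only [mul_assoc]

theorem eval_rotate_inv (s : List Bool) (a b c : YTree) :
    eval (s ++ [false]) a * eval (s ++ [true, false]) b * eval (s ++ [true, true]) c * (gx s)⁻¹ =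
      (gx s)⁻¹ * (eval (s ++ [false, false]) a * eval (s ++ [false, true]) b *
        eval (s ++ [true]) c) := by
  rw [mul_inv_eq_iff_eq_mul, mul_assoc (gx s)⁻¹, eval_rotate, inv_mul_cancel_left]

theorem independent_siblings (s v w : List Bool) :
    Independent (s ++ false :: v) (s ++ true :: w) := independent_append s (by simp) v w

/-- Pairwise commuting triples can be multiplied factor by factor. -/
theorem mul_mul_mul_of_commute {a b c d e f : Pres} (h1 : Commute d b) (h2 : Commute d c)
    (h3 : Commute e c) : a * b * c * (d * e * f) = a * d * (b * e * (c * f)) := by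
  have h4 : Commute d (b * c) := h1.mul_right h2
  calc a * b * c * (d * e * f) = a * (b * c * d) * (e * f) := by simp only [mul_assoc]
    _ = a * (d * (b * c)) * (e * f) := by rw [h4.eq]
    _ = a * d * b * (c * e) * f := by simp only [mul_assoc]
    _ = a * d * b * (e * c) * f := by rw [h3.eq]
    _ = _ := by simp only [mul_assoc]

/-- A factor `y` at the root is expanded by `y_expand`; the rotation carries the three subtrees to
their new places, and each receives one factor at its own root because independent cones commute. -/
theorem eval_mul_gy (s : List Bool) (a b c : YTree) :
    eval (s ++ [false, false]) a * eval (s ++ [false, true]) b * eval (s ++ [true]) c * gy s =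
      gx s * (eval (s ++ [false]) a * gy (s ++ [false]) *
        (eval (s ++ [true, false]) b * (gy (s ++ [true, false]))⁻¹ *
          (eval (s ++ [true, true]) c * gy (s ++ [true, true])))) := by
  have h := gy_expand s
  simp only [mul_assoc] at h
  have i1 : Independent (s ++ [false]) (s ++ [true, false]) := independent_siblings s [] _
  have i2 : Independent (s ++ [false]) (s ++ [true, true]) := independent_siblings s [] _
  have i3 : Independent (s ++ [true, false]) (s ++ [true, true]) := by
    simpa using independent_siblings (s ++ [true]) [] []
  rw [h, ← mul_assoc, eval_rotate, mul_assoc, ← mul_assoc (gy _), mul_mul_mul_of_commute]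
  · exact commute_of_independent i1 (gy_mem_coneG _) (eval_mem_coneG _ _)
  · exact commute_of_independent i2 (gy_mem_coneG _) (eval_mem_coneG _ _)
  · exact commute_of_independent i3 (inv_mem (gy_mem_coneG _)) (eval_mem_coneG _ _)

/-- This is the mirror image of `y_expand`. It follows by inverting that relation and moving `x` to
the front. -/
theorem gy_inv_expand (s : List Bool) : (gy s)⁻¹ = (gx s)⁻¹ *
    ((gy (s ++ [false, false]))⁻¹ * gy (s ++ [false, true]) * (gy (s ++ [true]))⁻¹) := by
  have i1 : Independent (s ++ [false]) (s ++ [true, false]) := independent_siblings s [] _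
  have i2 : Independent (s ++ [false]) (s ++ [true, true]) := independent_siblings s [] _
  have i3 : Independent (s ++ [true, false]) (s ++ [true, true]) := by
    simpa using independent_siblings (s ++ [true]) [] []
  -- One-vertex trees with exponents `-1`, `1`, `-1` turn the rotation lemma into the conjugation of
  -- these three letters by `x_s`.
  have h0 := eval_rotate s (node (-1) leaf leaf) (node 1 leaf leaf) (node (-1) leaf leaf)
  simp only [eval, one_mul, zpow_neg, zpow_one] at h0
  have h1 := mul_mul_mul_of_commute (a := gy (s ++ [false])) (f := (gy (s ++ [true, true]))⁻¹)
    (commute_of_independent i1 (inv_mem (gy_mem_coneG _)) (inv_mem (gy_mem_coneG _)))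
    (commute_of_independent i2 (inv_mem (gy_mem_coneG _)) (gy_mem_coneG _))
    (commute_of_independent i3 (gy_mem_coneG _) (gy_mem_coneG _))
  rw [mul_inv_cancel, inv_mul_cancel, mul_inv_cancel, one_mul, one_mul] at h1
  rw [← eq_mul_inv_iff_mul_eq] at h0
  rw [inv_eq_iff_mul_eq_one, h0, gy_expand s]
  calc _ = gx s * (gy (s ++ [false]) * (gy (s ++ [true, false]))⁻¹ * gy (s ++ [true, true]) *
      ((gy (s ++ [false]))⁻¹ * gy (s ++ [true, false]) * (gy (s ++ [true, true]))⁻¹)) *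
      (gx s)⁻¹ := by group
    _ = 1 := by rw [h1, mul_one, mul_inv_cancel]

theorem eval_mul_gy_inv (s : List Bool) (a b c : YTree) :
    eval (s ++ [false]) a * eval (s ++ [true, false]) b * eval (s ++ [true, true]) c * (gy s)⁻¹ =
      (gx s)⁻¹ * (eval (s ++ [false, false]) a * (gy (s ++ [false, false]))⁻¹ *
        (eval (s ++ [false, true]) b * gy (s ++ [false, true]) *
          (eval (s ++ [true]) c * (gy (s ++ [true]))⁻¹))) := by
  have i1 : Independent (s ++ [false, false]) (s ++ [false, true]) := by
    simpa using independent_siblings (s ++ [false]) [] []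
  have i2 : Independent (s ++ [false, false]) (s ++ [true]) := independent_siblings s _ []
  have i3 : Independent (s ++ [false, true]) (s ++ [true]) := independent_siblings s _ []
  rw [gy_inv_expand, ← mul_assoc, eval_rotate_inv, mul_assoc, mul_mul_mul_of_commute]
  · exact commute_of_independent i1 (inv_mem (gy_mem_coneG _)) (eval_mem_coneG _ _)
  · exact commute_of_independent i2 (inv_mem (gy_mem_coneG _)) (eval_mem_coneG _ _)
  · exact commute_of_independent i3 (gy_mem_coneG _) (eval_mem_coneG _ _)

/-! ### Moving the exponents away from the root -/

theorem weight_addRoot (e : ℤ) (t : YTree) : weight (addRoot e t) ≤ weight t + e.natAbs := by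
  cases t with
  | leaf => simp [addRoot, weight]
  | node k l r => simp only [addRoot, weight]; omega

/-- If `pos` is admitted, the old root exponent is nonnegative. If it is zero, admissibility passes
to the children, which is the condition a positive exponent imposes. -/
theorem reduced_addRoot_one {t : YTree} (h : Reduced t) (hp : Admits .pos t) :
    Reduced (addRoot 1 t) ∧ ∀ σ, σ ≠ Phase.neg → Admits σ (addRoot 1 t) := by
  cases t with
  | leaf => simp [addRoot, Reduced, Admits]
  | node k l r =>
    obtain ⟨h1, h2, h3, h4⟩ := h
    obtain ⟨h5, h6, h7⟩ := hp
    have hk : 0 ≤ k := not_lt.1 fun h => h6 h rfl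
    refine ⟨⟨h1, h2, fun _ => ?_, fun h => by omega⟩,
      fun σ hσ => ⟨fun _ => hσ, fun h => by omega, fun h => by omega⟩⟩
    rcases hk.eq_or_lt with rfl | hk
    · exact h7 rfl
    · exact h3 hk

theorem reduced_addRoot_neg_one {t : YTree} (h : Reduced t) (hp : Admits .neg t) :
    Reduced (addRoot (-1) t) ∧ ∀ σ, σ ≠ Phase.pos → Admits σ (addRoot (-1) t) := by
  cases t with
  | leaf => simp [addRoot, Reduced, Admits]
  | node k l r =>
    obtain ⟨h1, h2, h3, h4⟩ := h
    obtain ⟨h5, h6, h7⟩ := hp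
    have hk : k ≤ 0 := not_lt.1 fun h => h5 h rfl
    refine ⟨⟨h1, h2, fun h => by omega, fun _ => ?_⟩,
      fun σ hσ => ⟨fun h => by omega, fun _ => hσ, fun h => by omega⟩⟩
    rcases hk.eq_or_lt with rfl | hk
    · exact h7 rfl
    · exact h4 hk

/-- Induction on the bound for the weight, not on the size of the tree, since expansion may create
vertices. The clause on phases lets the surroundings of the tree remain reduced and allows the lemma
to be applied again to its own output. -/
theorem exists_deepen (n : ℕ) (s : List Bool) (t : YTree) (hn : weight t ≤ n) (ht : Reduced t) :
    ∃ f ∈ coneF s, ∃ a b, eval s t = f * (eval (s ++ [false]) a * eval (s ++ [true]) b) ∧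
      Reduced a ∧ Reduced b ∧
      (∀ σ : Phase, Admits σ t → Admits (σ.step false) a ∧ Admits (σ.step true) b) ∧
      weight a ≤ n ∧ weight b ≤ n := by
  induction n generalizing s t with
  | zero =>
    cases t with
    | leaf =>
      exact ⟨1, one_mem _, leaf, leaf, by simp [eval], ht, ht, fun _ _ => ⟨trivial, trivial⟩,
        hn, hn⟩
    | node k l r =>
      simp only [weight] at hn
      obtain rfl : k = 0 := by omega
      exact ⟨1, one_mem _, l, r, by simp [eval], ht.1, ht.2.1, fun _ h => h.2.2 rfl, by omega,
        by omega⟩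
  | succ n ih =>
    cases t with
    | leaf =>
      exact ⟨1, one_mem _, leaf, leaf, by simp [eval], ht, ht, fun _ _ => ⟨trivial, trivial⟩,
        by simp [weight], by simp [weight]⟩
    | node k l r =>
      simp only [weight] at hn
      obtain ⟨hl, hr, hpos, hneg⟩ := ht
      rcases lt_trichotomy k 0 with hk | rfl | hk
      -- One factor `y⁻¹` is split off, and the rest is deepened at the root and again on the right,
      -- as `y⁻¹` reads `0`, `10` or `11`. The phase `neg` arrives there as `neg`, `pos`, `neg`,
      -- matching the exponents `-1`, `1`, `-1` to be added.
      · obtain ⟨f, hf, a, b, he, ha, hb, had, hwa, hwb⟩ := ih s (node (k + 1) l r)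
          (by simp only [weight]; omega) ⟨hl, hr, fun h => by omega, fun _ => hneg hk⟩
        have had := had .neg ⟨fun h => by omega, fun _ => nofun, fun _ => hneg hk⟩
        obtain ⟨f', hf', b, c, he', hb, hc, had', hwb, hwc⟩ := ih (s ++ [true]) b hwb hb
        have had' := had' _ had.2
        obtain ⟨ha₁, ha₂⟩ := reduced_addRoot_neg_one ha had.1
        obtain ⟨hb₁, hb₂⟩ := reduced_addRoot_one hb had'.1
        obtain ⟨hc₁, hc₂⟩ := reduced_addRoot_neg_one hc had'.2
        have hcomm : Commute f' (eval (s ++ [false]) a) :=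
          (commute_of_independent (independent_siblings s [] []) (eval_mem_coneG _ a)
            (coneF_le_coneG _ hf')).symm
        refine ⟨f * f' * (gx s)⁻¹, mul_mem (mul_mem hf (coneF_append_le _ _ hf'))
          (inv_mem (gx_mem_coneF s)), node 0 (addRoot (-1) a) (addRoot 1 b), addRoot (-1) c,
          ?_, ⟨ha₁, hb₁, fun h => by omega, fun h => by omega⟩, hc₁, fun σ hσ => ?_, ?_, ?_⟩
        · have e1 : eval s (node k l r) = eval s (node (k + 1) l r) * (gy s)⁻¹ := by
            rw [eval, eval, zpow_add_one, ← mul_assoc _ _ (gy s), mul_inv_cancel_right]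
          have e2 := eval_mul_gy_inv s a b c
          simp only [List.append_assoc, List.cons_append, List.nil_append] at he' e2 hcomm
          rw [e1, he, he', eval_node_zero, eval_addRoot, eval_addRoot, eval_addRoot,
            ← mul_assoc _ f', ← hcomm.eq]
          simp only [List.append_assoc, List.cons_append, List.nil_append, zpow_neg, zpow_one]
          simp only [mul_assoc] at e2 ⊢
          rw [e2]
        · have hσ : σ ≠ .pos := hσ.2.1 hk
          cases σ with
          | pos => exact absurd rfl hσ
          | mid => exact ⟨⟨fun h => by omega, fun h => by omega,
              fun _ => ⟨ha₂ _ nofun, hb₂ _ nofun⟩⟩, hc₂ _ nofun⟩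
          | neg => exact ⟨⟨fun h => by omega, fun h => by omega,
              fun _ => ⟨ha₂ _ nofun, hb₂ _ nofun⟩⟩, hc₂ _ nofun⟩
        · have h1 := weight_addRoot (-1) a
          have h2 := weight_addRoot 1 b
          simp only [weight]; omega
        · have h1 := weight_addRoot (-1) c
          omega
      · exact ⟨1, one_mem _, l, r, by simp [eval], hl, hr, fun _ h => h.2.2 rfl, by omega,
          by omega⟩
      -- Symmetrically, `y` reads `00`, `01` or `1`, so the second deepening is on the left; the
      -- phases are `pos`, `neg`, `pos`.
      · obtain ⟨f, hf, a, c, he, ha, hc, had, hwa, hwc⟩ := ih s (node (k - 1) l r)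
          (by simp only [weight]; omega) ⟨hl, hr, fun _ => hpos hk, fun h => by omega⟩
        have had := had .pos ⟨fun _ => nofun, fun h => by omega, fun _ => hpos hk⟩
        obtain ⟨f', hf', a, b, he', ha, hb, had', hwa, hwb⟩ := ih (s ++ [false]) a hwa ha
        have had' := had' _ had.1
        obtain ⟨ha₁, ha₂⟩ := reduced_addRoot_one ha had'.1
        obtain ⟨hb₁, hb₂⟩ := reduced_addRoot_neg_one hb had'.2
        obtain ⟨hc₁, hc₂⟩ := reduced_addRoot_one hc had.2
        refine ⟨f * f' * gx s, mul_mem (mul_mem hf (coneF_append_le _ _ hf'))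
          (gx_mem_coneF s), addRoot 1 a, node 0 (addRoot (-1) b) (addRoot 1 c),
          ?_, ha₁, ⟨hb₁, hc₁, fun h => by omega, fun h => by omega⟩, fun σ hσ => ?_, ?_, ?_⟩
        · have e1 : eval s (node k l r) = eval s (node (k - 1) l r) * gy s := by
            rw [eval, eval, zpow_sub_one, ← mul_assoc _ _ (gy s)⁻¹, inv_mul_cancel_right]
          have e2 := eval_mul_gy s a b c
          simp only [List.append_assoc, List.cons_append, List.nil_append] at he' e2
          rw [e1, he, he', eval_node_zero, eval_addRoot, eval_addRoot, eval_addRoot]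
          simp only [List.append_assoc, List.cons_append, List.nil_append, zpow_neg, zpow_one]
          simp only [mul_assoc] at e2 ⊢
          rw [e2]
        · have hσ : σ ≠ .neg := hσ.1 hk
          cases σ with
          | neg => exact absurd rfl hσ
          | mid => exact ⟨ha₂ _ nofun, ⟨fun h => by omega, fun h => by omega,
              fun _ => ⟨hb₂ _ nofun, hc₂ _ nofun⟩⟩⟩
          | pos => exact ⟨ha₂ _ nofun, ⟨fun h => by omega, fun h => by omega,
              fun _ => ⟨hb₂ _ nofun, hc₂ _ nofun⟩⟩⟩
        · have h1 := weight_addRoot 1 a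
          omega
        · have h1 := weight_addRoot (-1) b
          have h2 := weight_addRoot 1 c
          simp only [weight]; omega


/-! ### Multiplication by generators -/

/-- `g` is the product of an element of `F` that is supported in the cone of `s` and the value of a
reduced tree placed at `s`. -/
def ConeForm (s : List Bool) (g : Pres) : Prop :=
  ∃ f ∈ coneF s, ∃ t, Reduced t ∧ g = f * eval s t

theorem ConeForm.mul_left {s : List Bool} {f g : Pres} (hg : ConeForm s g) (hf : f ∈ coneF s) :
    ConeForm s (f * g) := by
  obtain ⟨f', hf', t, ht, rfl⟩ := hg
  exact ⟨f * f', mul_mem hf hf', t, ht, (mul_assoc _ _ _).symm⟩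

theorem coneForm_eval (s : List Bool) {t : YTree} (ht : Reduced t) : ConeForm s (eval s t) :=
  ⟨1, one_mem _, t, ht, (one_mul _).symm⟩

theorem ConeForm.mem_coneG {s : List Bool} {g : Pres} (h : ConeForm s g) : g ∈ coneG s := by
  obtain ⟨f, hf, t, -, rfl⟩ := h
  exact mul_mem (coneF_le_coneG s hf) (eval_mem_coneG s t)

/-- The `F`-part of the right factor commutes past the left tree because their cones are
independent. -/
theorem ConeForm.siblings {s : List Bool} {g h : Pres} (hg : ConeForm (s ++ [false]) g)
    (hh : ConeForm (s ++ [true]) h) : ConeForm s (g * h) := by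
  have hgm := hg.mem_coneG
  obtain ⟨f, hf, t, ht, rfl⟩ := hg
  obtain ⟨f', hf', t', ht', rfl⟩ := hh
  refine ⟨f * f', mul_mem (coneF_append_le _ _ hf) (coneF_append_le _ _ hf'), node 0 t t',
    ⟨ht, ht', fun h => by omega, fun h => by omega⟩, ?_⟩
  have hc : Commute (eval (s ++ [false]) t) f' :=
    commute_of_independent (independent_siblings s [] []) (eval_mem_coneG _ t)
      (coneF_le_coneG _ hf')
  rw [eval_node_zero, mul_assoc, ← mul_assoc _ f', hc.eq]
  simp only [mul_assoc]

theorem Reduced.addRoot_of_ne {k : ℤ} {l r : YTree} (h : Reduced (node k l r)) (e : ℤ)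
    (hp : 0 < k + e → 0 < k) (hn : k + e < 0 → k < 0) : Reduced (addRoot e (node k l r)) :=
  ⟨h.1, h.2.1, fun h' => h.2.2.1 (hp h'), fun h' => h.2.2.2 (hn h')⟩

/-- In a cone, values of reduced trees can be multiplied by `y` and `y⁻¹`; moreover the exponents
can be moved away from the root in such a way that the left part can be multiplied by `y`
and the right part by `y⁻¹`. -/
theorem coneForm_mul_gy_aux (t : YTree) (ht : Reduced t) :
    (∀ s, ConeForm s (eval s t * gy s)) ∧ (∀ s, ConeForm s (eval s t * (gy s)⁻¹)) ∧
      ∀ s, ∃ f ∈ coneF s, ∃ a b, eval s t = f * (eval (s ++ [false]) a * eval (s ++ [true]) b) ∧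
        (∀ u, ConeForm u (eval u a * gy u)) ∧ ∀ u, ConeForm u (eval u b * (gy u)⁻¹) := by
  have hpos {t : YTree} (h : Reduced (addRoot 1 t)) (s : List Bool) :
      ConeForm s (eval s t * gy s) := by
    have := coneForm_eval s h
    rwa [eval_addRoot, zpow_one] at this
  have hneg {t : YTree} (h : Reduced (addRoot (-1) t)) (s : List Bool) :
      ConeForm s (eval s t * (gy s)⁻¹) := by
    have := coneForm_eval s h
    rwa [eval_addRoot, zpow_neg, zpow_one] at this
  have hleaf : Reduced leaf := trivial
  induction t with
  | leaf =>
    have h1 : Reduced (addRoot 1 leaf) := (reduced_addRoot_one hleaf trivial).1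
    have h2 : Reduced (addRoot (-1) leaf) := (reduced_addRoot_neg_one hleaf trivial).1
    exact ⟨hpos h1, hneg h2, fun s => ⟨1, one_mem _, leaf, leaf, by simp [eval], hpos h1,
      hneg h2⟩⟩
  | node k l r hl hr =>
    by_cases hk : k = 0
    · subst hk
      obtain ⟨hlp, hln, hls⟩ := hl ht.1
      obtain ⟨hrp, hrn, hrs⟩ := hr ht.2.1
      refine ⟨fun s => ?_, fun s => ?_, fun s => ?_⟩
      -- The expansion of `y` puts `y` on the part below `00`, `y⁻¹` below `01` and `y` below `1`.
      -- The third claim for `l` provides the first two, and the first claim for `r` provides the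
      -- last.
      · obtain ⟨f, hf, a, b, he, ha, hb⟩ := hls (s ++ [false])
        have e := eval_mul_gy s a b r
        have key : ConeForm s (eval (s ++ [false]) a * gy (s ++ [false]) *
            (eval (s ++ [true, false]) b * (gy (s ++ [true, false]))⁻¹ *
              (eval (s ++ [true, true]) r * gy (s ++ [true, true])))) := by
          refine (ha _).siblings (ConeForm.siblings ?_ ?_)
          · simpa using hb (s ++ [true, false])
          · simpa using hrp (s ++ [true, true])
        have h := key.mul_left (mul_mem (coneF_append_le _ _ hf) (gx_mem_coneF s))
        rw [mul_assoc, ← e] at h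
        rw [eval_node_zero, he]
        simpa [mul_assoc] using h
      · obtain ⟨f, hf, b, c, he, hb, hc⟩ := hrs (s ++ [true])
        have e := eval_mul_gy_inv s l b c
        have key : ConeForm s (eval (s ++ [false, false]) l * (gy (s ++ [false, false]))⁻¹ *
            (eval (s ++ [false, true]) b * gy (s ++ [false, true])) *
              (eval (s ++ [true]) c * (gy (s ++ [true]))⁻¹)) := by
          refine (ConeForm.siblings ?_ ?_).siblings (hc _)
          · simpa using hln (s ++ [false, false])
          · simpa using hb (s ++ [false, true])
        have h := key.mul_left (mul_mem (coneF_append_le _ _ hf) (inv_mem (gx_mem_coneF s)))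
        rw [mul_assoc (eval _ l * _), mul_assoc f, ← e] at h
        have hcomm : Commute f (eval (s ++ [false]) l) :=
          (commute_of_independent (independent_siblings s [] []) (eval_mem_coneG _ l)
            (coneF_le_coneG _ hf)).symm
        rw [eval_node_zero, he, ← mul_assoc _ f, ← hcomm.eq]
        simpa [mul_assoc] using h
      · exact ⟨1, one_mem _, l, r, by rw [eval_node_zero, one_mul], hlp, hrn⟩
    -- A nonzero exponent changed by one keeps its sign or becomes zero, so the tree stays reduced.
    · refine ⟨hpos (ht.addRoot_of_ne 1 (by omega) (by omega)),
        hneg (ht.addRoot_of_ne (-1) (by omega) (by omega)), fun s => ?_⟩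
      obtain ⟨f, hf, a, b, he, ha, hb, had, -⟩ := exists_deepen _ s _ le_rfl ht
      -- A root exponent of either sign admits `mid`, which steps to `pos` on the left and to `neg`
      -- on the right; hence `1` and `-1` can be added there.
      obtain ⟨h1, h2⟩ := had .mid ⟨fun _ => nofun, fun _ => nofun, fun h => absurd h hk⟩
      exact ⟨f, hf, a, b, he, hpos (reduced_addRoot_one ha h1).1,
        hneg (reduced_addRoot_neg_one hb h2).1⟩

/-- Two deepenings clear the vertices `s` and `s0`, where the rotation `x_s` takes place; the
remaining subtrees are carried along by it. -/
theorem coneForm_mul_gx {t : YTree} (ht : Reduced t) (s : List Bool) :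
    ConeForm s (eval s t * gx s) := by
  obtain ⟨f, hf, l, c, he, hl, hc, -⟩ := exists_deepen _ s t le_rfl ht
  obtain ⟨f', hf', a, b, he', ha, hb, -⟩ := exists_deepen _ (s ++ [false]) l le_rfl hl
  have e := eval_rotate s a b c
  have key : ConeForm s (eval (s ++ [false]) a *
      (eval (s ++ [true, false]) b * eval (s ++ [true, true]) c)) := by
    refine (coneForm_eval _ ha).siblings (ConeForm.siblings ?_ ?_)
    · simpa using coneForm_eval (s ++ [true, false]) hb
    · simpa using coneForm_eval (s ++ [true, true]) hc
  have h := key.mul_left (mul_mem (mul_mem hf (coneF_append_le _ _ hf')) (gx_mem_coneF s))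
  rw [mul_assoc, ← mul_assoc (eval _ a), ← e] at h
  rw [he, he']
  simpa [mul_assoc] using h

theorem coneForm_mul_gx_inv {t : YTree} (ht : Reduced t) (s : List Bool) :
    ConeForm s (eval s t * (gx s)⁻¹) := by
  obtain ⟨f, hf, a, r, he, ha, hr, -⟩ := exists_deepen _ s t le_rfl ht
  obtain ⟨f', hf', b, c, he', hb, hc, -⟩ := exists_deepen _ (s ++ [true]) r le_rfl hr
  have e := eval_rotate_inv s a b c
  have key : ConeForm s (eval (s ++ [false, false]) a * eval (s ++ [false, true]) b *
      eval (s ++ [true]) c) := by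
    refine (ConeForm.siblings ?_ ?_).siblings (coneForm_eval _ hc)
    · simpa using coneForm_eval (s ++ [false, false]) ha
    · simpa using coneForm_eval (s ++ [false, true]) hb
  have h := key.mul_left (mul_mem (mul_mem hf (coneF_append_le _ _ hf'))
    (inv_mem (gx_mem_coneF s)))
  rw [mul_assoc, ← e] at h
  have hcomm : Commute f' (eval (s ++ [false]) a) :=
    (commute_of_independent (independent_siblings s [] []) (eval_mem_coneG _ a)
      (coneF_le_coneG _ hf')).symm
  rw [he, he', ← mul_assoc _ f', ← hcomm.eq]
  simpa [mul_assoc] using h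

/-- If values of reduced trees at a vertex can be multiplied by the elements `H s`, then they can
be multiplied by `H (s ++ w)`. -/
theorem coneForm_mul_append {H : List Bool → Pres} (hG : ∀ s, H s ∈ coneG s)
    (hH : ∀ {t}, Reduced t → ∀ s, ConeForm s (eval s t * H s)) (w s : List Bool) {t : YTree}
    (ht : Reduced t) : ConeForm s (eval s t * H (s ++ w)) := by
  induction w generalizing s t with
  | nil => simpa using hH ht s
  | cons b w ih =>
    obtain ⟨f, hf, l, r, he, hl, hr, -⟩ := exists_deepen _ s t le_rfl ht
    rw [he]
    cases b
    · have h1 := ih (s ++ [false]) hl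
      have h2 := (h1.siblings (coneForm_eval _ hr)).mul_left hf
      have hc : Commute (H (s ++ [false] ++ w)) (eval (s ++ [true]) r) :=
        commute_of_independent (independent_siblings s [] [])
          (coneG_append_le _ _ (hG _)) (eval_mem_coneG _ r)
      rw [mul_assoc (eval _ l), hc.eq] at h2
      simpa [mul_assoc] using h2
    · have h2 := ((coneForm_eval _ hl).siblings (ih (s ++ [true]) hr)).mul_left hf
      simpa [mul_assoc] using h2

/-- `g` is the product of an element of `T` and the value of a reduced tree. -/
def HasNormalForm (g : Pres) : Prop := ∃ τ ∈ presT, ∃ t, Reduced t ∧ g = τ * eval [] t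

theorem HasNormalForm.mul_of_coneForm {g h : Pres} (hg : HasNormalForm g)
    (hh : ∀ {t}, Reduced t → ConeForm [] (eval [] t * h)) : HasNormalForm (g * h) := by
  obtain ⟨τ, hτ, t, ht, rfl⟩ := hg
  obtain ⟨f, hf, t', ht', he⟩ := hh ht
  exact ⟨τ * f, mul_mem hτ (coneF_le_presT _ hf), t', ht', by rw [mul_assoc, he, mul_assoc]⟩

theorem HasNormalForm.mul_gx {g : Pres} (hg : HasNormalForm g) (s : List Bool) :
    HasNormalForm (g * gx s) :=
  hg.mul_of_coneForm fun ht =>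
    coneForm_mul_append (fun s => coneF_le_coneG s (gx_mem_coneF s)) coneForm_mul_gx s [] ht

theorem HasNormalForm.mul_gx_inv {g : Pres} (hg : HasNormalForm g) (s : List Bool) :
    HasNormalForm (g * (gx s)⁻¹) :=
  hg.mul_of_coneForm fun ht => coneForm_mul_append (H := fun s => (gx s)⁻¹)
    (fun s => inv_mem (coneF_le_coneG s (gx_mem_coneF s))) coneForm_mul_gx_inv s [] ht

theorem HasNormalForm.mul_gy {g : Pres} (hg : HasNormalForm g) (s : List Bool) :
    HasNormalForm (g * gy s) :=
  hg.mul_of_coneForm fun ht =>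
    coneForm_mul_append gy_mem_coneG (fun ht => (coneForm_mul_gy_aux _ ht).1) s [] ht

theorem HasNormalForm.mul_gy_inv {g : Pres} (hg : HasNormalForm g) (s : List Bool) :
    HasNormalForm (g * (gy s)⁻¹) :=
  hg.mul_of_coneForm fun ht => coneForm_mul_append (H := fun s => (gy s)⁻¹)
    (fun s => inv_mem (gy_mem_coneG s)) (fun ht => (coneForm_mul_gy_aux _ ht).2.1) s [] ht

/-- As `p_0` exchanges the cones of `0` and `1`, it suffices to clear the root exponent and swap the
two subtrees. -/
theorem HasNormalForm.mul_gp_zero {g : Pres} (hg : HasNormalForm g) :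
    HasNormalForm (g * gp 0) := by
  obtain ⟨τ, hτ, t, ht, rfl⟩ := hg
  obtain ⟨f, hf, a, b, he, ha, hb, -⟩ := exists_deepen _ [] t le_rfl ht
  refine ⟨τ * f * gp 0, mul_mem (mul_mem hτ (coneF_le_presT _ hf)) (gp_mem_presT 0), node 0 b a,
    ⟨hb, ha, fun h => by omega, fun h => by omega⟩, ?_⟩
  have h0 : ActsTo (p 0) [false] [true] := actsTo_p (n := 0) (i := 0) (by omega)
  have h1 : ActsTo (p 0) [true] [false] := actsTo_p (n := 0) (i := 1) (by omega)
  have ea : eval [false] a * gp 0 = gp 0 * eval [true] a :=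
    (eval_semiconj (fun w => (gy_gp (h0.append w)).symm) a).eq.symm
  have eb : eval [true] b * gp 0 = gp 0 * eval [false] b :=
    (eval_semiconj (fun w => (gy_gp (h1.append w)).symm) b).eq.symm
  have hc : Commute (eval [true] a) (eval [false] b) :=
    commute_of_independent (independent_siblings [] [] []).symm (eval_mem_coneG _ a)
      (eval_mem_coneG _ b)
  rw [he, eval_node_zero]
  simp only [List.nil_append, mul_assoc]
  rw [eb, ← mul_assoc (eval _ a), ea, mul_assoc, hc.eq]

theorem HasNormalForm.mul_gp {g : Pres} (hg : HasNormalForm g) (n : ℕ) :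
    HasNormalForm (g * gp n) := by
  induction n generalizing g with
  | zero => exact hg.mul_gp_zero
  | succ n ih =>
    -- By `p_eq`, `p_{n+1}` is the product of the inverse of `x` at `1ⁿ` and `p_n`.
    have h := ih (hg.mul_gx_inv (ones n))
    rwa [gp_eq n, mul_assoc, inv_mul_cancel_left] at h

theorem HasNormalForm.mul_gp_inv {g : Pres} (hg : HasNormalForm g) (n : ℕ) :
    HasNormalForm (g * (gp n)⁻¹) := by
  have h (k : ℕ) : HasNormalForm (g * gp n ^ k) := by
    induction k with
    | zero => simpa using hg
    | succ k ih => rw [pow_succ, ← mul_assoc]; exact ih.mul_gp n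
  rw [inv_eq_of_mul_eq_one_left (a := gp n ^ (n + 1)) (by rw [← pow_succ, gp_pow])]
  exact h _

theorem hasNormalForm (g : Pres) : HasNormalForm g := by
  have hg : g ∈ Subgroup.closure (Set.range (PresentedGroup.of (rels := relators))) := by
    rw [PresentedGroup.closure_range_of]; trivial
  induction hg using Subgroup.closure_induction_right with
  | one => exact ⟨1, one_mem _, leaf, trivial, by simp [eval]⟩
  | mul_right g _ h hh ih =>
    obtain ⟨s | s | n, rfl⟩ := hh
    · exact ih.mul_gy s
    · exact ih.mul_gx s
    · exact ih.mul_gp n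
  | mul_inv_cancel g _ h hh ih =>
    obtain ⟨s | s | n, rfl⟩ := hh
    · exact ih.mul_gy_inv s
    · exact ih.mul_gx_inv s
    · exact ih.mul_gp_inv n


/-! ### The action of labelled trees on the Cantor set -/

/-- `y` or its inverse. -/
def ySign : Bool → BinSeq ≃ₜ BinSeq
  | true => y
  | false => y⁻¹

/-- The initial phase of the transducer for `y` or its inverse. -/
def Phase.ofSign : Bool → Phase
  | true => .pos
  | false => .neg

theorem Phase.ofSign_ne (ε : Bool) : Phase.ofSign ε ≠ Phase.ofSign !ε := by
  cases ε <;> exact nofun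

/-- The phase after reading a finite sequence. -/
def Phase.run (σ : Phase) (u : List Bool) : Phase := u.foldl Phase.step σ

theorem Phase.run_append (σ : Phase) (u v : List Bool) : σ.run (u ++ v) = (σ.run u).run v :=
  List.foldl_append

theorem y_00 (η : BinSeq) : y (app [false, false] η) = app [false] (y η) := yFun_00 η
theorem y_01 (η : BinSeq) : y (app [false, true] η) = app [true, false] (y⁻¹ η) := yFun_01 η
theorem y_1 (η : BinSeq) : y (app [true] η) = app [true, true] (y η) := yFun_1 η
theorem y_inv_0 (η : BinSeq) : y⁻¹ (app [false] η) = app [false, false] (y⁻¹ η) := yInvFun_0 η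
theorem y_inv_10 (η : BinSeq) : y⁻¹ (app [true, false] η) = app [false, true] (y η) :=
  yInvFun_10 η
theorem y_inv_11 (η : BinSeq) : y⁻¹ (app [true, true] η) = app [true] (y⁻¹ η) := yInvFun_11 η

/-- One step of the transducer. -/
theorem exists_output_append {ε ε' δ : Bool} {i o u : List Bool}
    (h1 : ∀ ζ, ySign ε (app i ζ) = app o (ySign ε' ζ))
    (h2 : ∀ τ, τ ≠ Phase.ofSign (!ε) → Phase.run τ o ≠ Phase.ofSign !ε')
    (h : ∃ v, (∀ ζ, ySign ε' (app u ζ) = app v (ySign δ ζ)) ∧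
      ∀ τ, τ ≠ Phase.ofSign (!ε') → Phase.run τ v ≠ Phase.ofSign !δ) :
    ∃ v, (∀ ζ, ySign ε (app (i ++ u) ζ) = app v (ySign δ ζ)) ∧
      ∀ τ, τ ≠ Phase.ofSign (!ε) → Phase.run τ v ≠ Phase.ofSign !δ := by
  obtain ⟨v, h3, h4⟩ := h
  refine ⟨o ++ v, fun ζ => ?_, fun τ hτ => ?_⟩
  · rw [app_append, h1, h3, app_append]
  · rw [Phase.run_append]; exact h4 _ (h2 τ hτ)

/-- If the transducer is in one of the phases `pos` or `neg` after reading `u`, then it replaces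
the prefix `u`; a transducer that reads its output does not cancel afterwards if it did not cancel
before. -/
theorem exists_output (ε δ : Bool) : (u : List Bool) →
    (Phase.ofSign ε).run u = Phase.ofSign δ →
    ∃ v, (∀ ζ, ySign ε (app u ζ) = app v (ySign δ ζ)) ∧
      ∀ τ, τ ≠ Phase.ofSign (!ε) → Phase.run τ v ≠ Phase.ofSign !δ
  | [], h => by
    obtain rfl : ε = δ := by
      cases ε <;> cases δ <;> first | rfl | exact absurd h nofun
    exact ⟨[], fun ζ => rfl, fun τ hτ => hτ⟩
  | b :: u, h => by
    cases ε
    · cases b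
      · exact exists_output_append (i := [false]) (o := [false, false]) (ε' := false) y_inv_0
          (fun τ hτ => by
            cases τ <;> first | exact absurd rfl hτ | exact nofun) (exists_output false δ u h)
      · match u, h with
        | [], h => cases δ <;> exact absurd h nofun
        | false :: u, h =>
          exact exists_output_append (i := [true, false]) (o := [false, true]) (ε' := true)
            y_inv_10 (fun τ hτ => by
              cases τ <;> first | exact absurd rfl hτ | exact nofun) (exists_output true δ u h)
        | true :: u, h =>
          exact exists_output_append (i := [true, true]) (o := [true]) (ε' := false)
            y_inv_11 (fun τ hτ => by
              cases τ <;> first | exact absurd rfl hτ | exact nofun) (exists_output false δ u h)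
    · cases b
      · match u, h with
        | [], h => cases δ <;> exact absurd h nofun
        | false :: u, h =>
          exact exists_output_append (i := [false, false]) (o := [false]) (ε' := true)
            y_00 (fun τ hτ => by
              cases τ <;> first | exact absurd rfl hτ | exact nofun) (exists_output true δ u h)
        | true :: u, h =>
          exact exists_output_append (i := [false, true]) (o := [true, false]) (ε' := false)
            y_01 (fun τ hτ => by
              cases τ <;> first | exact absurd rfl hτ | exact nofun) (exists_output false δ u h)
      · exact exists_output_append (i := [true]) (o := [true, true]) (ε' := true) y_1
          (fun τ hτ => by
            cases τ <;> first | exact absurd rfl hτ | exact nofun) (exists_output true δ u h)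

/-! ### Powers of `y` on runs of one digit -/

theorem ySign_cons_self (δ : Bool) (ζ : BinSeq) :
    ySign δ (cons δ ζ) = cons δ (cons δ (ySign δ ζ)) := by
  cases δ
  · exact y_inv_0 ζ
  · exact y_1 ζ

theorem ySign_cons_not (δ : Bool) (ζ : BinSeq) :
    ySign δ (cons (!δ) (cons (!δ) ζ)) = cons (!δ) (ySign δ ζ) := by
  cases δ
  · exact y_inv_11 ζ
  · exact y_00 ζ

theorem pow_succ_apply (f : BinSeq ≃ₜ BinSeq) (n : ℕ) (ζ : BinSeq) :
    (f ^ (n + 1)) ζ = (f ^ n) (f ζ) := by rw [pow_succ, Homeomorph.mul_apply]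

theorem ySign_app_replicate_self (δ : Bool) (m : ℕ) (ζ : BinSeq) :
    ySign δ (app (List.replicate m δ) ζ) = app (List.replicate (2 * m) δ) (ySign δ ζ) := by
  induction m with
  | zero => rfl
  | succ m ih =>
    rw [List.replicate_succ, app, ySign_cons_self, ih]; rfl

theorem ySign_app_replicate_not (δ : Bool) (m : ℕ) (ζ : BinSeq) :
    ySign δ (app (List.replicate (2 * m) !δ) ζ) = app (List.replicate m !δ) (ySign δ ζ) := by
  induction m with
  | zero => rfl
  | succ m ih =>
    rw [Nat.mul_add, List.replicate_succ, List.replicate_succ, app, app, ySign_cons_not, ih]; rfl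

theorem exists_ySign_pow_app_replicate (δ : Bool) (n m : ℕ) :
    ∃ k, ∀ ζ, (ySign δ ^ n) (app (List.replicate m δ) ζ) =
      app (List.replicate k δ) ((ySign δ ^ n) ζ) := by
  induction n generalizing m with
  | zero => exact ⟨m, fun ζ => rfl⟩
  | succ n ih =>
    obtain ⟨k, hk⟩ := ih (2 * m)
    exact ⟨k, fun ζ => by
      rw [pow_succ_apply, ySign_app_replicate_self, hk, ← pow_succ_apply]⟩

/-- Each application halves a run of the digit `!δ`, so `n` applications shrink a run of length `2 ^
n` to one digit. -/
theorem ySign_pow_app_replicate_not (δ : Bool) (n : ℕ) (ζ : BinSeq) :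
    (ySign δ ^ n) (app (List.replicate (2 ^ n) !δ) ζ) = app [!δ] ((ySign δ ^ n) ζ) := by
  induction n generalizing ζ with
  | zero => rfl
  | succ n ih =>
    rw [pow_succ_apply, pow_succ' 2 n, ySign_app_replicate_not, ih, ← pow_succ_apply]

/-- On some cone, `F` is of the form `ζ ↦ u (ζ · yᵏ)` with `k ≠ 0`, where the `k` copies of `y` do
not cancel with a transducer that enters in a phase that satisfies `C`. -/
def Escapes (F : BinSeq → BinSeq) (C : Phase → Prop) : Prop :=
  ∃ q u δ n, (∀ ζ, F (app q ζ) = app u ((ySign δ ^ (n + 1)) ζ)) ∧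
    ∀ τ, C τ → Phase.run τ u ≠ Phase.ofSign !δ

/-- The new transducer reads `u` and does not end in the phase that would cancel. Either it ends in
the phase of `δ` and adds one more factor, or it ends in `mid` and needs one more digit. -/
theorem Escapes.comp {F : BinSeq → BinSeq} {C : Phase → Prop} (h : Escapes F C) {ε : Bool}
    (hC : C (.ofSign ε)) : Escapes (fun ζ => ySign ε (F ζ)) (· ≠ .ofSign !ε) := by
  obtain ⟨q, u, δ, n, h1, h2⟩ := h
  have h3 := h2 _ hC
  by_cases h4 : (Phase.ofSign ε).run u = .ofSign δ
  · obtain ⟨v, h5, h6⟩ := exists_output ε δ u h4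
    refine ⟨q, v, δ, n + 1, fun ζ => ?_, h6⟩
    beta_reduce
    rw [h1, h5, pow_succ' _ (n + 1), Homeomorph.mul_apply]
  -- From `mid` the digit `!δ` leads to the phase of `δ`. To supply it after `n + 1` factors, the
  -- cone is refined by `2 ^ (n + 1)` copies of that digit.
  · have h5 : (Phase.ofSign ε).run (u ++ [!δ]) = .ofSign δ := by
      rw [Phase.run_append]
      generalize (Phase.ofSign ε).run u = σ at h3 h4
      cases σ <;> cases δ <;> first | rfl | exact absurd rfl h3 | exact absurd rfl h4
    obtain ⟨v, h6, h7⟩ := exists_output ε δ _ h5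
    refine ⟨q ++ List.replicate (2 ^ (n + 1)) !δ, v, δ, n + 1, fun ζ => ?_, h7⟩
    beta_reduce
    rw [app_append, h1, ySign_pow_app_replicate_not, ← app_append, h6, pow_succ' _ (n + 1),
      Homeomorph.mul_apply]

theorem Escapes.pow_comp {F : BinSeq → BinSeq} {C : Phase → Prop} (h : Escapes F C) {ε : Bool}
    (hC : C (.ofSign ε)) (n : ℕ) :
    Escapes (fun ζ => (ySign ε ^ (n + 1)) (F ζ)) (· ≠ .ofSign !ε) := by
  induction n with
  | zero => simpa using h.comp hC
  | succ n ih =>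
    simpa only [pow_succ' _ (n + 1), Homeomorph.mul_apply] using ih.comp (Phase.ofSign_ne ε)

theorem escapes_pow (ε : Bool) (n : ℕ) :
    Escapes (fun ζ => (ySign ε ^ (n + 1)) ζ) (· ≠ .ofSign !ε) :=
  ⟨[], [], ε, n, fun _ => rfl, fun _ h => h⟩

/-- The map of the Cantor set that a labelled tree describes. -/
def evalFun : YTree → BinSeq → BinSeq
  | leaf, ζ => ζ
  | node k l r, ζ =>
      (y ^ k) (cons (ζ 0) (if ζ 0 = true then evalFun r (drop 1 ζ) else evalFun l (drop 1 ζ)))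

theorem evalFun_false (k : ℤ) (l r : YTree) (ζ : BinSeq) :
    evalFun (node k l r) (cons false ζ) = (y ^ k) (cons false (evalFun l ζ)) := rfl

theorem evalFun_true (k : ℤ) (l r : YTree) (ζ : BinSeq) :
    evalFun (node k l r) (cons true ζ) = (y ^ k) (cons true (evalFun r ζ)) := rfl

theorem evalFun_node (k : ℤ) (l r : YTree) (ζ : BinSeq) :
    evalFun (node k l r) ζ = (y ^ k) (evalFun (node 0 l r) ζ) := rfl

theorem evalFun_of_isZero {t : YTree} (h : IsZero t) (ζ : BinSeq) : evalFun t ζ = ζ := by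
  induction t generalizing ζ with
  | leaf => rfl
  | node k l r hl hr =>
    obtain ⟨rfl, h1, h2⟩ := h
    obtain ⟨b, ζ, rfl⟩ := exists_cons ζ
    cases b
    · rw [evalFun_false, hl h1]; rfl
    · rw [evalFun_true, hr h2]; rfl

theorem act_of_mem_coneG {s u : List Bool} (h : Independent u s) {g : Pres} (hg : g ∈ coneG s)
    (η : BinSeq) : act g (app u η) = app u η := by
  induction hg using Subgroup.closure_induction with
  | mem g hg =>
    rcases hg with ⟨w, rfl⟩ | ⟨w, rfl⟩
    · exact act_gx_of_independent (h.append_left w) η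
    · rw [act_gy]; exact ActsTo.localize_of_independent (h.append_left w) y η
  | one => exact act_one _
  | mul g k _ _ hg hk => rw [act_mul, hg, hk]
  | inv g _ hg => rw [← hg, act_inv_act, hg]

theorem act_gy_zpow (s : List Bool) (k : ℤ) (ζ : BinSeq) :
    act (gy s ^ k) (app s ζ) = app s ((y ^ k) ζ) := by
  have h : toHomeo (gy s ^ k) = localizeHom s (MulOpposite.op (y ^ k)) := by
    rw [map_zpow, toHomeo_gy, MulOpposite.op_zpow, map_zpow]; rfl
  unfold act
  rw [h]
  exact localize_app s _ ζ

/-- On each half of the cone the sibling subtree acts trivially, so only the subtree of that half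
and the power at the root matter. -/
theorem act_eval (s : List Bool) (t : YTree) (ζ : BinSeq) :
    act (eval s t) (app s ζ) = app s (evalFun t ζ) := by
  induction t generalizing s ζ with
  | leaf => exact act_one _
  | node k l r hl hr =>
    obtain ⟨b, ζ, rfl⟩ := exists_cons ζ
    have e (b : Bool) (ζ : BinSeq) : app s (cons b ζ) = app (s ++ [b]) ζ := by
      rw [app_append]; rfl
    rw [eval, act_mul, act_mul, e]
    cases b
    · rw [hl, act_of_mem_coneG (independent_siblings s [] []) (eval_mem_coneG _ r), ← e,
        act_gy_zpow, evalFun_false]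
    · rw [act_of_mem_coneG (independent_siblings s [] []).symm (eval_mem_coneG _ l), hr, ← e,
        act_gy_zpow, evalFun_true]

theorem y_zpow_of_pos {k : ℤ} (hk : 0 < k) : ∃ n : ℕ, y ^ k = ySign true ^ (n + 1) :=
  ⟨k.toNat - 1, by
    rw [← zpow_natCast]
    congr 1
    omega⟩

theorem y_zpow_of_neg {k : ℤ} (hk : k < 0) : ∃ n : ℕ, y ^ k = ySign false ^ (n + 1) :=
  ⟨(-k).toNat - 1, by
    rw [← zpow_natCast, ySign, inv_zpow']
    congr 1
    omega⟩

/-- Follow a branch with a nonzero exponent. The deepest one gives a power of `y`; each exponent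
above it is applied later and, by reducedness, meets it without cancellation. Both children are
discarded only when all their exponents are zero. -/
theorem escapes_of_reduced {t : YTree} (ht : Reduced t) (h0 : ¬ IsZero t) :
    Escapes (evalFun t) (Admits · t) := by
  induction t with
  | leaf => exact absurd trivial h0
  | node k l r hl hr =>
    obtain ⟨htl, htr, hpos, hneg⟩ := ht
    have key : (IsZero l ∧ IsZero r) ∨ Escapes (evalFun (node 0 l r)) (Admits · (node 0 l r)) := by
      by_cases h1 : IsZero l
      · by_cases h2 : IsZero r
        · exact Or.inl ⟨h1, h2⟩
        · obtain ⟨q, u, δ, n, h3, h4⟩ := hr htr h2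
          refine Or.inr ⟨true :: q, true :: u, δ, n, fun ζ => ?_, fun τ hτ => ?_⟩
          · rw [app, evalFun_true, h3]; rfl
          · exact h4 _ (hτ.2.2 rfl).2
      · obtain ⟨q, u, δ, n, h3, h4⟩ := hl htl h1
        refine Or.inr ⟨false :: q, false :: u, δ, n, fun ζ => ?_, fun τ hτ => ?_⟩
        · rw [app, evalFun_false, h3]; rfl
        · exact h4 _ (hτ.2.2 rfl).1
    have hmono {C D : Phase → Prop} {F : BinSeq → BinSeq} (h : Escapes F C) (hCD : ∀ τ, D τ → C τ) :
        Escapes F D := by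
      obtain ⟨q, u, δ, n, h3, h4⟩ := h
      exact ⟨q, u, δ, n, h3, fun τ hτ => h4 τ (hCD τ hτ)⟩
    have e : evalFun (node k l r) = fun ζ => (y ^ k) (evalFun (node 0 l r) ζ) :=
      funext (evalFun_node k l r)
    rcases lt_trichotomy k 0 with hk | rfl | hk
    · obtain ⟨n, hn⟩ := y_zpow_of_neg hk
      refine hmono (C := (· ≠ .ofSign !false)) ?_ fun τ hτ => hτ.2.1 hk
      rw [e, hn]
      rcases key with ⟨h1, h2⟩ | key
      · simpa only [evalFun_of_isZero (t := node 0 l r) ⟨rfl, h1, h2⟩] using escapes_pow false n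
      · exact key.pow_comp (ε := false) ⟨fun h => by omega, fun h => by omega, fun _ => hneg hk⟩ n
    · rcases key with ⟨h1, h2⟩ | key
      · exact absurd ⟨rfl, h1, h2⟩ h0
      · exact key
    · obtain ⟨n, hn⟩ := y_zpow_of_pos hk
      refine hmono (C := (· ≠ .ofSign !true)) ?_ fun τ hτ => hτ.1 hk
      rw [e, hn]
      rcases key with ⟨h1, h2⟩ | key
      · simpa only [evalFun_of_isZero (t := node 0 l r) ⟨rfl, h1, h2⟩] using escapes_pow true n
      · exact key.pow_comp (ε := true) ⟨fun h => by omega, fun h => by omega, fun _ => hpos hk⟩ n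

/-! ### Powers of `y` are not prefix replacements -/

theorem eq_const_of_eq_cons_cons {ξ : BinSeq} {b : Bool} (h : ξ = cons b (cons b ξ)) :
    ∀ n, ξ n = b
  | 0 => by rw [h]; rfl
  | 1 => by rw [h]; rfl
  | n + 2 => by rw [h]; exact eq_const_of_eq_cons_cons h n

theorem const_eq_cons (b : Bool) : (fun _ => b : BinSeq) = cons b fun _ => b := by
  funext n; cases n <;> rfl

theorem ySign_const (δ b : Bool) : ySign δ (fun _ => b) = fun _ => b := by
  refine funext (eq_const_of_eq_cons_cons ?_)
  by_cases hb : b = δ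
  · subst hb
    conv_lhs => rw [const_eq_cons, ySign_cons_self]
  · obtain rfl : b = !δ := by cases b <;> cases δ <;> simp_all
    have h : ySign δ (fun _ => !δ) = cons (!δ) (ySign δ fun _ => !δ) := by
      conv_lhs => rw [const_eq_cons, const_eq_cons, ySign_cons_not]
    rw [← h, ← h]

theorem ySign_pow_const (δ b : Bool) (n : ℕ) : (ySign δ ^ n) (fun _ => b) = fun _ => b := by
  induction n with
  | zero => rfl
  | succ n ih => rw [pow_succ_apply, ySign_const, ih]

theorem exists_ySign_pow_cons (δ : Bool) (n : ℕ) (ζ : BinSeq) :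
    ∃ ζ', (ySign δ ^ (n + 1)) (cons δ ζ) = cons δ (cons δ ζ') := by
  induction n generalizing ζ with
  | zero => exact ⟨_, by rw [zero_add, pow_one, ySign_cons_self]⟩
  | succ n ih =>
    obtain ⟨ζ', h⟩ := ih (cons δ (ySign δ ζ))
    exact ⟨ζ', by rw [pow_succ_apply, ySign_cons_self, h]⟩

/-- Constant sequences are fixed by `y`, which forces `u = v`. The power would then be the identity,
but it maps `δ` followed by a constant `!δ` to a sequence beginning with `δδ`. -/
theorem not_ySign_pow_eq_prefix (δ : Bool) (n : ℕ) (u v : List Bool) :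
    ¬ ∀ ζ, app u ((ySign δ ^ (n + 1)) ζ) = app v ζ := by
  intro h
  obtain rfl : u = v := eq_of_app_const_eq fun b => by
    rw [← h, ySign_pow_const]
  obtain ⟨ζ', hζ⟩ := exists_ySign_pow_cons δ n fun _ => !δ
  have h1 := app_injective u (h (cons δ fun _ => !δ))
  rw [hζ] at h1
  have h2 := congrFun h1 1
  cases δ <;> exact absurd h2 (by simp [cons])

/-! ### Elements that locally replace prefixes -/

/-- Near every point, the homeomorphism replaces a prefix. -/
def LocallyPrefix (h : BinSeq ≃ₜ BinSeq) : Prop := ∀ ξ, ∃ q u ζ, ξ = app q ζ ∧ ActsTo h q u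

theorem LocallyPrefix.symm {h : BinSeq ≃ₜ BinSeq} (hh : LocallyPrefix h) :
    LocallyPrefix h.symm := fun ξ => by
  obtain ⟨q, u, ζ, h1, h2⟩ := hh (h.symm ξ)
  refine ⟨u, q, ζ, ?_, fun η => ?_⟩
  · rw [← h2, ← h1, h.apply_symm_apply]
  · rw [← h2, h.symm_apply_apply]

theorem LocallyPrefix.trans {h k : BinSeq ≃ₜ BinSeq} (hh : LocallyPrefix h)
    (hk : LocallyPrefix k) : LocallyPrefix (h.trans k) := fun ξ => by
  obtain ⟨q, u, ζ, rfl, h2⟩ := hh ξ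
  obtain ⟨q', v, ζ', h3, h4⟩ := hk (app u ζ)
  rcases prefix_or_of_app_eq h3 with ⟨w, rfl⟩ | ⟨w, rfl⟩
  · rw [app_append] at h3
    refine ⟨q ++ w, v, ζ', ?_, fun η => ?_⟩
    · rw [app_append, ← app_injective u h3]
    · rw [app_append, Homeomorph.trans_apply, h2, ← app_append, h4]
  · refine ⟨q, v ++ w, ζ, rfl, fun η => ?_⟩
    rw [Homeomorph.trans_apply, h2, app_append, h4, app_append]

theorem LocallyPrefix.localize {h : BinSeq ≃ₜ BinSeq} (hh : LocallyPrefix h) (s : List Bool) :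
    LocallyPrefix (localize s h) := by
  induction s with
  | nil => exact hh
  | cons b s ih =>
    intro ξ
    obtain ⟨c, ξ, rfl⟩ := exists_cons ξ
    by_cases hc : c = b
    · subst hc
      obtain ⟨q, u, ζ, rfl, h2⟩ := ih ξ
      exact ⟨c :: q, c :: u, ζ, rfl, h2.localize_append [c]⟩
    · refine ⟨[c], [c], ξ, rfl, fun η => ?_⟩
      exact (under_cons b c _ η).trans (if_neg hc)

theorem locallyPrefix_x : LocallyPrefix x := fun ξ => by
  rcases cases_source ξ with ⟨η, rfl⟩ | ⟨η, rfl⟩ | ⟨η, rfl⟩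
  · exact ⟨_, _, η, rfl, actsTo_x_00⟩
  · exact ⟨_, _, η, rfl, actsTo_x_01⟩
  · exact ⟨_, _, η, rfl, actsTo_x_1⟩

theorem locallyPrefix_p (n : ℕ) : LocallyPrefix (p n) := fun ξ => by
  obtain ⟨i, hi, η, rfl⟩ := exists_vineLeaf (n + 1) ξ
  exact ⟨_, _, η, rfl, actsTo_p hi⟩

theorem locallyPrefix_of_mem_presT {g : Pres} (hg : g ∈ presT) :
    LocallyPrefix (toHomeo g).unop := by
  induction hg using Subgroup.closure_induction with
  | mem g hg =>
    rcases hg with ⟨s, rfl⟩ | ⟨n, rfl⟩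
    · rw [toHomeo_gx]; exact locallyPrefix_x.localize s
    · rw [toHomeo_gp]; exact locallyPrefix_p n
  | one => exact fun ξ => ⟨[], [], ξ, rfl, fun η => act_one η⟩
  | mul g h _ _ hg hh => rw [map_mul]; exact hg.trans hh
  | inv g _ hg => rw [map_inv]; exact hg.symm

theorem not_locallyPrefix_of_escapes {h : BinSeq ≃ₜ BinSeq} {C : Phase → Prop}
    (he : Escapes h C) : ¬ LocallyPrefix h := by
  intro hh
  obtain ⟨q, u, δ, n, h1, -⟩ := he
  -- At the point `q` followed by the constant `δ`, any longer prefix is `q δᵐ`, and powers of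
  -- `ySign δ` send the run `δᵐ` to another run of `δ`. The difference can thus be absorbed into the
  -- output prefix.
  obtain ⟨q', u', ζ', h2, h3⟩ := hh (app q fun _ => δ)
  rcases prefix_or_of_app_eq h2 with ⟨w, rfl⟩ | ⟨w, rfl⟩
  · rw [app_append] at h2
    have hw : ∃ m, w = List.replicate m δ := by
      have h4 := app_injective q h2
      clear h2 h3
      induction w with
      | nil => exact ⟨0, rfl⟩
      | cons b w ih =>
        obtain rfl : δ = b := congrFun h4 0
        obtain ⟨m, rfl⟩ := ih (by rw [← drop_cons δ (app w ζ'), ← app, ← h4]; rfl)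
        exact ⟨m + 1, rfl⟩
    obtain ⟨m, rfl⟩ := hw
    obtain ⟨k, hk⟩ := exists_ySign_pow_app_replicate δ (n + 1) m
    refine not_ySign_pow_eq_prefix δ n (u ++ List.replicate k δ) u' fun ζ => ?_
    rw [app_append, ← hk, ← h1, ← app_append, h3]
  · refine not_ySign_pow_eq_prefix δ n u (u' ++ w) fun ζ => ?_
    rw [← h1, app_append, h3, app_append]

end YTree

/-! ### Injectivity and image of the homomorphism -/

open YTree

theorem toHomeo_injective : Function.Injective toHomeo := by
  rw [injective_iff_map_eq_one]
  intro g hg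
  obtain ⟨τ, hτ, t, ht, rfl⟩ := hasNormalForm g
  have h0 : IsZero t := by
    by_contra h0
    have he := escapes_of_reduced ht h0
    -- The tree part acts as the inverse of `τ`, hence by local prefix replacements, which a reduced
    -- tree with a nonzero exponent cannot do.
    have h1 : toHomeo (eval [] t) = toHomeo τ⁻¹ := by
      rw [map_mul] at hg
      rw [map_inv, eq_inv_of_mul_eq_one_right hg]
    have h2 : evalFun t = (toHomeo τ⁻¹).unop := by
      rw [← h1]
      exact funext fun ζ => (act_eval [] t ζ).symm
    rw [h2] at he
    exact not_locallyPrefix_of_escapes he (locallyPrefix_of_mem_presT (inv_mem hτ))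
  rw [eval_eq_one h0, mul_one] at hg ⊢
  exact eq_one_of_mem_presT hτ fun ξ => by unfold act; rw [hg]; rfl

theorem range_toHomeo : toHomeo.range = SHat := by
  have h : toHomeo.range = Subgroup.closure (Set.range Gen.toHomeo) := by
    rw [MonoidHom.range_eq_map, ← PresentedGroup.closure_range_of, MonoidHom.map_closure,
      ← Set.range_comp]
    rfl
  rw [h]
  apply le_antisymm
  · rw [Subgroup.closure_le]
    rintro _ ⟨s | s | n, rfl⟩
    · exact Subgroup.mem_sup_left (Subgroup.subset_closure (Or.inr ⟨s, rfl⟩))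
    · exact Subgroup.mem_sup_left (Subgroup.subset_closure
        (Or.inl (Subgroup.subset_closure ⟨s, rfl⟩)))
    · exact Subgroup.mem_sup_right (Subgroup.subset_closure (Or.inr ⟨n, rfl⟩))
  · have hF : thompsonF ≤ Subgroup.closure (Set.range Gen.toHomeo) := by
      refine (Subgroup.closure_le _).2 ?_
      rintro _ ⟨s, rfl⟩
      exact Subgroup.subset_closure ⟨.x s, rfl⟩
    refine sup_le ((Subgroup.closure_le _).2 ?_) ((Subgroup.closure_le _).2 ?_)
    · refine Set.union_subset hF ?_
      rintro _ ⟨s, rfl⟩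
      exact Subgroup.subset_closure ⟨.y s, rfl⟩
    · refine Set.union_subset hF ?_
      rintro _ ⟨n, rfl⟩
      exact Subgroup.subset_closure ⟨.p n, rfl⟩

end LodhaMoore

/-- The group `Ŝ` is presented by the generators `y_s`, `x_s`, `p_n` and the relations listed in
`LodhaMoore.Relation`: sending each generator symbol to the homeomorphism of that name gives a
well-defined isomorphism from the presented group onto `Ŝ`. -/
theorem proposition6p3 :
    ∃ φ : PresentedGroup LodhaMoore.relators ≃* LodhaMoore.SHat,
      ∀ g : LodhaMoore.Gen,
        ((φ (PresentedGroup.of g) : LodhaMoore.SHat) : LodhaMoore.HomeoR) = g.toHomeo :=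
  ⟨(MonoidHom.ofInjective LodhaMoore.toHomeo_injective).trans
    (MulEquiv.subgroupCongr LodhaMoore.range_toHomeo), fun _ => rfl⟩
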